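/- Let $\gamma\in\mathbb R$ and consider the Euler equations of a perfect polytropic gas in three space dimensions, $$\begin{aligned} u_t+uu_x+vu_y+wu_z+\tfrac1q p_x&=0,\\ v_t+uv_x+vv_y+wv_z+\tfrac1q p_y&=0,\\ w_t+uw_x+vw_y+ww_z+\tfrac1q p_z&=0,\\ q_t+q(u_x+v_y+w_z)+uq_x+vq_y+wq_z&=0,\\ p_t+\gamma p(u_x+v_y+w_z)+up_x+vp_y+wp_z&=0, \end{aligned}\tag{1}$$ for the velocity $(u,v,w)$, the pressure $p$ and the density $q$ as functions of $(t,x,y,z)$. Let $U$ be a nonempty connected open subset of the space of the variables $(t,x,y,z,u,v,w,p,q)$ on which $q\neq0$. A real $C^\infty$ vector field $$X=\xi_1\partial_t+\xi_2\partial_x+\xi_3\partial_y+\xi_4\partial_z+\eta_1\partial_u+\eta_2\partial_v+\eta_3\partial_w+\eta_4\partial_p+\eta_5\partial_q$$ on $U$ is called an infinitesimal (point) symmetry of (1) if its first prolongation $\mathrm{pr}\,X$ satisfies $\mathrm{pr}\,X(\Delta_k)=0$, $k=1,\dots,5$, at all points of the first jet space over $U$ at which $\Delta_1=\dots=\Delta_5=0$,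 where $\Delta_k$ are the left-hand sides of (1). Consider on $U$ the vector fields $$\begin{aligned} &X_1=\partial_x,\quad X_2=\partial_y,\quad X_3=\partial_z,\quad X_4=\partial_t,\\ &X_5=t\partial_x+\partial_u,\quad X_6=t\partial_y+\partial_v,\quad X_7=t\partial_z+\partial_w,\\ &X_8=t\partial_t-u\partial_u-v\partial_v-w\partial_w+2q\partial_q,\\ &X_9=x\partial_x+y\partial_y+z\partial_z+u\partial_u+v\partial_v+w\partial_w-2q\partial_q,\\ &X_{10}=y\partial_x-x\partial_y+v\partial_u-u\partial_v,\\ &X_{11}=-z\partial_y+y\partial_z-w\partial_v+v\partial_w,\\ &X_{12}=-z\partial_x+x\partial_z-w\partial_u+u\partial_w,\\ &X_{13}=q\partial_q+p\partial_p. \end{aligned}$$ Then $X_1,\dots,X_{13}$ are linearly independent infinitesimal symmetries of (1), and their commutators $[X_i,X_j]=X_iX_j-X_jX_i$ are determined by antisymmetry and the following list, in which the pairs $i<j$ that are not listed have $[X_i,X_j]=0$: $$\begin{aligned} &[X_1,X_9]=X_1,\ [X_1,X_{10}]=-X_2,\ [X_1,X_{12}]=X_3,\\ &[X_2,X_9]=X_2,\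 [X_2,X_{10}]=X_1,\ [X_2,X_{11}]=X_3,\\ &[X_3,X_9]=X_3,\ [X_3,X_{11}]=-X_2,\ [X_3,X_{12}]=-X_1,\\ &[X_4,X_5]=X_1,\ [X_4,X_6]=X_2,\ [X_4,X_7]=X_3,\ [X_4,X_8]=X_4,\\ &[X_5,X_8]=-X_5,\ [X_5,X_9]=X_5,\ [X_5,X_{10}]=-X_6,\ [X_5,X_{12}]=X_7,\\ &[X_6,X_8]=-X_6,\ [X_6,X_9]=X_6,\ [X_6,X_{10}]=X_5,\ [X_6,X_{11}]=X_7,\\ &[X_7,X_8]=-X_7,\ [X_7,X_9]=X_7,\ [X_7,X_{11}]=-X_6,\ [X_7,X_{12}]=-X_5,\\ &[X_{10},X_{11}]=-X_{12},\ [X_{10},X_{12}]=X_{11},\ [X_{11},X_{12}]=-X_{10}. \end{aligned}$$ If moreover $\gamma\neq0$ and $\gamma\neq\tfrac53$, then the infinitesimal symmetries of (1) on $U$ form a real Lie algebra under the commutator, and this Lie algebra is spanned by $X_1,\dots,X_{13}$. -/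

import Mathlib

open scoped ContDiff

namespace PolytropicGas

/-- The space of independent and dependent variables
`m = ((t, x, y, z), (u, v, w, p, q))`: time and space coordinates, the velocity `(u, v, w)`,
the pressure `p` and the density `q`. -/
abbrev PointSpace : Type := (Fin 4 → ℝ) × (Fin 5 → ℝ)

/-- The first jet space of maps `(t, x, y, z) ↦ (u, v, w, p, q)`. In a jet `(m, J)` the number
`J α i` is the coordinate standing for the derivative of the `α`-th dependent variable in the
`i`-th independent variable. -/
abbrev JetSpace : Type := PointSpace × (Fin 5 → Fin 4 → ℝ)

/-- The left-hand sides of the Euler equations of a perfect polytropic gas with adiabatic index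
`γ`, as functions on the first jet space:
`u_t + u u_x + v u_y + w u_z + p_x / q`,
`v_t + u v_x + v v_y + w v_z + p_y / q`,
`w_t + u w_x + v w_y + w w_z + p_z / q`,
`q_t + q (u_x + v_y + w_z) + u q_x + v q_y + w q_z`,
`p_t + γ p (u_x + v_y + w_z) + u p_x + v p_y + w p_z`. -/
noncomputable def eulerSystem (γ : ℝ) (j : JetSpace) : Fin 5 → ℝ :=
  let u := j.1.2 0
  let v := j.1.2 1
  let w := j.1.2 2
  let p := j.1.2 3
  let q := j.1.2 4
  let du := j.2 0
  let dv := j.2 1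
  let dw := j.2 2
  let dp := j.2 3
  let dq := j.2 4
  ![du 0 + u * du 1 + v * du 2 + w * du 3 + 1 / q * dp 1,
    dv 0 + u * dv 1 + v * dv 2 + w * dv 3 + 1 / q * dp 2,
    dw 0 + u * dw 1 + v * dw 2 + w * dw 3 + 1 / q * dp 3,
    dq 0 + q * (du 1 + dv 2 + dw 3) + u * dq 1 + v * dq 2 + w * dq 3,
    dp 0 + γ * p * (du 1 + dv 2 + dw 3) + u * dp 1 + v * dp 2 + w * dp 3]

/-- The total derivative `D_i f = ∂f/∂xᵢ + ∑ α, J α i * ∂f/∂u_α` of a function `f` on the space of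
independent and dependent variables, at a jet. -/
noncomputable def totalDeriv (i : Fin 4) (f : PointSpace → ℝ) (j : JetSpace) : ℝ :=
  fderiv ℝ f j.1 (Pi.single i 1, fun α => j.2 α i)

/-- The first prolongation of the vector field `X = ∑ ξ_k ∂/∂x_k + ∑ η_α ∂/∂u_α`, a vector field on
the first jet space: its coefficient at `J α i` is `D_i η_α - ∑ k, J α k * D_i ξ_k`. -/
noncomputable def prolongation (X : PointSpace → PointSpace) (j : JetSpace) : JetSpace :=
  (X j.1, fun α i =>
    totalDeriv i (fun m => (X m).2 α) j - ∑ k, j.2 α k * totalDeriv i (fun m => (X m).1 k) j)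

/-! ### The Lie algebra of smooth vector fields on an open set -/

/-- The space of `C^∞` vector fields on the open set `U`. Such a field is represented by its
extension by zero outside `U` (so that two fields are equal exactly if they agree on `U`). -/
def smoothSubmodule (U : TopologicalSpace.Opens PointSpace) :
    Submodule ℝ (PointSpace → PointSpace) where
  carrier := {X | ContDiffOn ℝ ∞ X U ∧ ∀ m, m ∉ U → X m = 0}
  zero_mem' := ⟨contDiffOn_const, fun _ _ => rfl⟩
  add_mem' := fun hX hY => ⟨hX.1.add hY.1, fun m hm => by simp [hX.2 m hm, hY.2 m hm]⟩
  smul_mem' := fun c _ hX => ⟨contDiffOn_const.smul hX.1, fun m hm => by simp [hX.2 m hm]⟩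

/-- `C^∞` vector fields on the open set `U`. -/
def SmoothVectorField (U : TopologicalSpace.Opens PointSpace) : Type := smoothSubmodule U

namespace SmoothVectorField

variable {U : TopologicalSpace.Opens PointSpace}

instance : AddCommGroup (SmoothVectorField U) := inferInstanceAs (AddCommGroup (smoothSubmodule U))

instance : Module ℝ (SmoothVectorField U) := inferInstanceAs (Module ℝ (smoothSubmodule U))

instance : CoeFun (SmoothVectorField U) (fun _ => PointSpace → PointSpace) := ⟨fun X => X.1⟩

theorem contDiffOn (X : SmoothVectorField U) : ContDiffOn ℝ ∞ X U := X.2.1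

theorem contDiffAt (X : SmoothVectorField U) {m : PointSpace} (hm : m ∈ U) :
    ContDiffAt ℝ ∞ X m := X.contDiffOn.contDiffAt (U.isOpen.mem_nhds hm)

theorem differentiableAt (X : SmoothVectorField U) {m : PointSpace} (hm : m ∈ U) :
    DifferentiableAt ℝ X m := (X.contDiffAt hm).differentiableAt (by simp)

theorem eq_zero (X : SmoothVectorField U) {m : PointSpace} (hm : m ∉ U) : X m = 0 := X.2.2 m hm

theorem ext {X Y : SmoothVectorField U} (h : ∀ m ∈ U, X m = Y m) : X = Y :=
  Subtype.ext (funext fun m => by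
    by_cases hm : m ∈ U
    · exact h m hm
    · exact (X.eq_zero hm).trans (Y.eq_zero hm).symm)

theorem coe_add (X Y : SmoothVectorField U) : (X + Y : SmoothVectorField U).1 = X.1 + Y.1 := rfl

theorem coe_smul (c : ℝ) (X : SmoothVectorField U) :
    (c • X : SmoothVectorField U).1 = c • X.1 := rfl

theorem coe_zero : (0 : SmoothVectorField U).1 = 0 := rfl

open Classical in
/-- The restriction to `U` of a vector field that is smooth on `U`. -/
noncomputable def restrict (U : TopologicalSpace.Opens PointSpace) (X : PointSpace → PointSpace)
    (hX : ContDiffOn ℝ ∞ X U) : SmoothVectorField U :=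
  ⟨fun m => if m ∈ U then X m else 0,
    hX.congr fun _ hm => if_pos hm, fun _ hm => if_neg hm⟩

theorem restrict_apply {X : PointSpace → PointSpace} (hX : ContDiffOn ℝ ∞ X U) {m : PointSpace}
    (hm : m ∈ U) : restrict U X hX m = X m := if_pos hm

/-- The commutator of vector fields, `[X, Y] = X Y - Y X` as differential operators; in coordinates
`[X, Y] = DY(X) - DX(Y)`. -/
noncomputable instance : Bracket (SmoothVectorField U) (SmoothVectorField U) :=
  ⟨fun X Y => restrict U (VectorField.lieBracket ℝ X Y) fun _ hm =>
    ((X.contDiffAt hm).lieBracket_vectorField (m := ∞) (n := ∞) (Y.contDiffAt hm)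
      (by simp)).contDiffWithinAt⟩

theorem bracket_apply (X Y : SmoothVectorField U) {m : PointSpace} (hm : m ∈ U) :
    ⁅X, Y⁆ m = VectorField.lieBracket ℝ X Y m := restrict_apply _ hm

theorem bracket_eventuallyEq (X Y : SmoothVectorField U) {m : PointSpace} (hm : m ∈ U) :
    (⁅X, Y⁆ : SmoothVectorField U).1 =ᶠ[nhds m] VectorField.lieBracket ℝ X Y :=
  Filter.eventually_of_mem (U.isOpen.mem_nhds hm) fun _ hn => bracket_apply X Y hn

noncomputable instance : LieRing (SmoothVectorField U) where
  add_lie X Y Z := ext fun m hm => by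
    rw [coe_add, Pi.add_apply, bracket_apply _ _ hm, bracket_apply _ _ hm, bracket_apply _ _ hm,
      coe_add, VectorField.lieBracket_add_left (X.differentiableAt hm) (Y.differentiableAt hm)]
  lie_add X Y Z := ext fun m hm => by
    rw [coe_add, Pi.add_apply, bracket_apply _ _ hm, bracket_apply _ _ hm, bracket_apply _ _ hm,
      coe_add, VectorField.lieBracket_add_right (Y.differentiableAt hm) (Z.differentiableAt hm)]
  lie_self X := ext fun _ hm => by
    rw [bracket_apply _ _ hm, VectorField.lieBracket_self, coe_zero]
  leibniz_lie X Y Z := ext fun m hm => by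
    rw [coe_add, Pi.add_apply, bracket_apply _ _ hm, bracket_apply _ _ hm, bracket_apply _ _ hm,
      (Filter.EventuallyEq.refl _ X.1).lieBracket_vectorField_eq (bracket_eventuallyEq Y Z hm),
      (bracket_eventuallyEq X Y hm).lieBracket_vectorField_eq (Filter.EventuallyEq.refl _ Z.1),
      (Filter.EventuallyEq.refl _ Y.1).lieBracket_vectorField_eq (bracket_eventuallyEq X Z hm)]
    exact VectorField.leibniz_identity_lieBracket (n := ∞)
      (by simpa using (WithTop.coe_le_coe.2 le_top : ((2 : ℕ∞) : WithTop ℕ∞) ≤ ∞)) (X.contDiffAt hm)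
      (Y.contDiffAt hm) (Z.contDiffAt hm)

noncomputable instance : LieAlgebra ℝ (SmoothVectorField U) where
  lie_smul c X Y := ext fun m hm => by
    rw [coe_smul, Pi.smul_apply, bracket_apply _ _ hm, bracket_apply _ _ hm, coe_smul,
      VectorField.lieBracket_const_smul_right (Y.differentiableAt hm)]

end SmoothVectorField

/-- The infinitesimal criterion of invariance: the smooth vector field `X` on `U` is an
infinitesimal (point) symmetry of the Euler system if its prolongation to the jet space annihilates
the left-hand sides of the system at all jets over `U` that satisfy the system, that is, if the
prolongation is tangent to the submanifold of the jet space defined by the system. -/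
def IsInfinitesimalSymmetry (γ : ℝ) {U : TopologicalSpace.Opens PointSpace}
    (X : SmoothVectorField U) : Prop :=
  ∀ j : JetSpace, j.1 ∈ U → eulerSystem γ j = 0 →
    fderiv ℝ (eulerSystem γ) j (prolongation X j) = 0

/-- The 13 vector fields `X₁, …, X₁₃` (numbered from `0`); the two vectors are the coefficients of
`(∂_t, ∂_x, ∂_y, ∂_z)` and of `(∂_u, ∂_v, ∂_w, ∂_p, ∂_q)`. -/
def generatorFun (i : Fin 13) (m : PointSpace) : PointSpace :=
  let t := m.1 0
  let x := m.1 1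
  let y := m.1 2
  let z := m.1 3
  let u := m.2 0
  let v := m.2 1
  let w := m.2 2
  let p := m.2 3
  let q := m.2 4
  match i with
  | 0 => (![0, 1, 0, 0], ![0, 0, 0, 0, 0])
  | 1 => (![0, 0, 1, 0], ![0, 0, 0, 0, 0])
  | 2 => (![0, 0, 0, 1], ![0, 0, 0, 0, 0])
  | 3 => (![1, 0, 0, 0], ![0, 0, 0, 0, 0])
  | 4 => (![0, t, 0, 0], ![1, 0, 0, 0, 0])
  | 5 => (![0, 0, t, 0], ![0, 1, 0, 0, 0])
  | 6 => (![0, 0, 0, t], ![0, 0, 1, 0, 0])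
  | 7 => (![t, 0, 0, 0], ![-u, -v, -w, 0, 2 * q])
  | 8 => (![0, x, y, z], ![u, v, w, 0, -2 * q])
  | 9 => (![0, y, -x, 0], ![v, -u, 0, 0, 0])
  | 10 => (![0, 0, -z, y], ![0, -w, v, 0, 0])
  | 11 => (![0, -z, 0, x], ![-w, 0, u, 0, 0])
  | 12 => (![0, 0, 0, 0], ![0, 0, 0, p, q])

theorem contDiff_generatorFun (i : Fin 13) : ContDiff ℝ ∞ (generatorFun i) := by
  refine ContDiff.prodMk (contDiff_pi.2 fun k => ?_) (contDiff_pi.2 fun k => ?_) <;>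
  fin_cases i <;> fin_cases k <;> simp <;> fun_prop

/-- The 13 vector fields on the open set `U`. -/
noncomputable def generator (U : TopologicalSpace.Opens PointSpace) (i : Fin 13) :
    SmoothVectorField U :=
  SmoothVectorField.restrict U (generatorFun i) (contDiff_generatorFun i).contDiffOn

/-- The commutator table in terms of the 13 fields `X`: the entry in row `i` and column `j` is the
value of `[X i, X j]`. -/
def commutatorTable {V : Type*} [AddCommGroup V] (X : Fin 13 → V) : Matrix (Fin 13) (Fin 13) V :=
  let X1 := X 0
  let X2 := X 1
  let X3 := X 2
  let X4 := X 3
  let X5 := X 4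
  let X6 := X 5
  let X7 := X 6
  let X10 := X 9
  let X11 := X 10
  let X12 := X 11
  !![ 0, 0, 0, 0, 0, 0, 0, 0, X1, -X2, 0, X3, 0;
      0, 0, 0, 0, 0, 0, 0, 0, X2, X1, X3, 0, 0;
      0, 0, 0, 0, 0, 0, 0, 0, X3, 0, -X2, -X1, 0;
      0, 0, 0, 0, X1, X2, X3, X4, 0, 0, 0, 0, 0;
      0, 0, 0, -X1, 0, 0, 0, -X5, X5, -X6, 0, X7, 0;
      0, 0, 0, -X2, 0, 0, 0, -X6, X6, X5, X7, 0, 0;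
      0, 0, 0, -X3, 0, 0, 0, -X7, X7, 0, -X6, -X5, 0;
      0, 0, 0, -X4, X5, X6, X7, 0, 0, 0, 0, 0, 0;
      -X1, -X2, -X3, 0, -X5, -X6, -X7, 0, 0, 0, 0, 0, 0;
      X2, -X1, 0, 0, X6, -X5, 0, 0, 0, 0, -X12, X11, 0;
      0, -X3, X2, 0, 0, -X7, X6, 0, 0, X12, 0, -X10, 0;
      -X3, 0, X1, 0, -X7, 0, X5, 0, 0, -X11, X10, 0, 0;
      0, 0, 0, 0, 0, 0, 0, 0, 0, 0, 0, 0, 0]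

end PolytropicGas

namespace PolytropicGas

/-! The Euler equations can be solved for the time derivatives, so over each point with q ≠ 0 the
jets that satisfy them are parametrized freely by the spatial gradients (V, P, Q) of velocity,
pressure and density (`solutionJet`). On these jets, invariance is a set of polynomial identities of
degree at most two in (V, P, Q), which can be tested on chosen gradients. Write τ, ξ for the
coefficients of ∂_t and of the spatial derivatives, and η, π, ρ for those of velocity, pressure and
density. Where p ≠ 0, the quadratic parts force τ and ξ to be independent of (u, v, w, p, q)
(`fiber_eq_zero`). What is left is affine in (V, P, Q), and its coefficients are the determining
equations (`determining_equations`).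

These are then differentiated in the algebra of smooth functions on U. It follows that τ has no
spatial derivatives, η = ξ_t + (u·∇)ξ - u τ_t, the second spatial derivatives of ξ vanish, ∇ξ is
antisymmetric plus a multiple of the identity, and π = p π_p. Mass and pressure together give (5 -
3γ) τ_tt = 0 (`dt_dt_τ`). For γ ≠ 5/3, τ and ξ have vanishing second derivatives and π_p is
constant. Connectedness of U makes the integration constants global, and exactly thirteen of them
are free: the coefficients of the generators (`mem_span`).

The generators are affine fields with constant derivative, so their invariance, commutators and
independence are finite algebraic checks. The symmetries are closed under the bracket because they
equal the span of the generators, which the commutator table closes. -/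

/-! ### Linearization of the system and the prolongation formula. -/

theorem differentiableAt_eulerSystem (γ : ℝ) {j : JetSpace} (hq : j.1.2 4 ≠ 0) :
    DifferentiableAt ℝ (eulerSystem γ) j := by
  refine differentiableAt_pi.2 fun k => ?_
  fin_cases k <;> simp only [eulerSystem] <;> simp <;> fun_prop (disch := assumption)

/-- The linearization of the left-hand sides of the Euler equations at the jet `j` in the direction
`d`. -/
noncomputable def linearizedEuler (γ : ℝ) (j d : JetSpace) : Fin 5 → ℝ :=
  let q := j.1.2 4
  let transport := fun α : Fin 5 => d.2 α 0 + ∑ k : Fin 3,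
    (j.1.2 (k.castAdd 2) * d.2 α k.succ + d.1.2 (k.castAdd 2) * j.2 α k.succ)
  let div := j.2 0 1 + j.2 1 2 + j.2 2 3
  let divd := d.2 0 1 + d.2 1 2 + d.2 2 3
  ![transport 0 + d.2 3 1 / q - d.1.2 4 * j.2 3 1 / q ^ 2,
    transport 1 + d.2 3 2 / q - d.1.2 4 * j.2 3 2 / q ^ 2,
    transport 2 + d.2 3 3 / q - d.1.2 4 * j.2 3 3 / q ^ 2,
    transport 4 + d.1.2 4 * div + q * divd,
    transport 3 + γ * d.1.2 3 * div + γ * j.1.2 3 * divd]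

theorem fderiv_eulerSystem (γ : ℝ) {j : JetSpace} (hq : j.1.2 4 ≠ 0) (d : JetSpace) :
    fderiv ℝ (eulerSystem γ) j d = linearizedEuler γ j d := by
  have hd := (differentiableAt_eulerSystem γ hq)
  -- Differentiability is known, so it suffices to differentiate along the line `j + s • d`, one
  -- coordinate at a time.
  rw [← hd.lineDeriv_eq_fderiv]
  refine HasLineDerivAt.lineDeriv ?_
  rw [HasLineDerivAt, hasDerivAt_pi]
  have hm : ∀ α, HasDerivAt (fun s : ℝ => j.1.2 α + s * d.1.2 α) (d.1.2 α) 0 := fun α => by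
    simpa using ((hasDerivAt_id (0 : ℝ)).mul_const (d.1.2 α)).const_add (j.1.2 α)
  have hJ : ∀ α i, HasDerivAt (fun s : ℝ => j.2 α i + s * d.2 α i) (d.2 α i) 0 := fun α i => by
    simpa using ((hasDerivAt_id (0 : ℝ)).mul_const (d.2 α i)).const_add (j.2 α i)
  have ht : ∀ α, HasDerivAt (fun s : ℝ => (j.2 α 0 + s * d.2 α 0) +
      (j.1.2 0 + s * d.1.2 0) * (j.2 α 1 + s * d.2 α 1) +
      (j.1.2 1 + s * d.1.2 1) * (j.2 α 2 + s * d.2 α 2) +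
      (j.1.2 2 + s * d.1.2 2) * (j.2 α 3 + s * d.2 α 3))
      (d.2 α 0 + ∑ k : Fin 3,
        (j.1.2 (k.castAdd 2) * d.2 α k.succ + d.1.2 (k.castAdd 2) * j.2 α k.succ)) 0 := fun α => by
    refine ((((hJ α 0).add ((hm 0).mul (hJ α 1))).add ((hm 1).mul (hJ α 2))).add
      ((hm 2).mul (hJ α 3))).congr_deriv ?_
    simp [Fin.sum_univ_three, Fin.succ]
    ring
  have hp : ∀ i, HasDerivAt (fun s : ℝ => 1 / (j.1.2 4 + s * d.1.2 4) * (j.2 3 i + s * d.2 3 i))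
      (d.2 3 i / j.1.2 4 - d.1.2 4 * j.2 3 i / j.1.2 4 ^ 2) 0 := fun i => by
    simp only [one_div]
    refine (((hm 4).inv (by simpa using hq)).mul (hJ 3 i)).congr_deriv ?_
    simp
    field_simp
    ring
  have hdiv := ((hJ 0 1).add (hJ 1 2)).add (hJ 2 3)
  intro k
  fin_cases k
  · refine ((ht 0).add (hp 1)).congr_deriv ?_
    simp [linearizedEuler]; ring
  · refine ((ht 1).add (hp 2)).congr_deriv ?_
    simp [linearizedEuler]; ring
  · refine ((ht 2).add (hp 3)).congr_deriv ?_
    simp [linearizedEuler]; ring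
  · refine HasDerivAt.congr_deriv (((ht 4).add ((hm 4).mul hdiv)).congr_of_eventuallyEq
      (Filter.Eventually.of_forall fun s => ?_)) ?_
    · simp [eulerSystem]; ring
    · simp [linearizedEuler]; ring
  · refine HasDerivAt.congr_deriv (((ht 3).add (((hm 3).const_mul γ).mul hdiv)).congr_of_eventuallyEq
      (Filter.Eventually.of_forall fun s => ?_)) ?_
    · simp [eulerSystem]; ring
    · simp [linearizedEuler]; ring

/-- The direction in the space of independent and dependent variables in which the total derivative
`D_i` differentiates at a jet with first derivatives `J`. -/
noncomputable def totalDir (J : Fin 5 → Fin 4 → ℝ) (i : Fin 4) : PointSpace :=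
  (Pi.single i 1, fun α => J α i)

theorem prolongation_eq {X : PointSpace → PointSpace} {j : JetSpace}
    (hX : DifferentiableAt ℝ X j.1) :
    prolongation X j = (X j.1, fun α i => (fderiv ℝ X j.1 (totalDir j.2 i)).2 α -
      ∑ k, j.2 α k * (fderiv ℝ X j.1 (totalDir j.2 i)).1 k) := by
  have h1 : ∀ k v, fderiv ℝ (fun m => (X m).1 k) j.1 v = (fderiv ℝ X j.1 v).1 k := fun k v => by
    have := ((ContinuousLinearMap.proj (R := ℝ) (φ := fun _ : Fin 4 => ℝ) k).comp
      (ContinuousLinearMap.fst ℝ (Fin 4 → ℝ) (Fin 5 → ℝ))).hasFDerivAt.comp j.1 hX.hasFDerivAt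
    exact congrArg (fun L => L v) this.fderiv
  have h2 : ∀ k v, fderiv ℝ (fun m => (X m).2 k) j.1 v = (fderiv ℝ X j.1 v).2 k := fun k v => by
    have := ((ContinuousLinearMap.proj (R := ℝ) (φ := fun _ : Fin 5 => ℝ) k).comp
      (ContinuousLinearMap.snd ℝ (Fin 4 → ℝ) (Fin 5 → ℝ))).hasFDerivAt.comp j.1 hX.hasFDerivAt
    exact congrArg (fun L => L v) this.fderiv
  simp only [prolongation, totalDeriv, h1, h2, totalDir]

/-! ### The thirteen fields: invariance, commutators, independence. -/

/-- The linear part of the affine vector field `generatorFun i`. -/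
noncomputable def generatorLinear (i : Fin 13) : PointSpace →L[ℝ] PointSpace :=
  LinearMap.toContinuousLinearMap
    { toFun := fun v => generatorFun i v - generatorFun i 0
      map_add' := fun v w => by
        fin_cases i <;> simp [generatorFun, add_comm, neg_add_eq_sub, mul_add]
      map_smul' := fun c v => by
        fin_cases i <;> simp [generatorFun, mul_left_comm] }

theorem generatorLinear_apply (i : Fin 13) (v : PointSpace) :
    generatorLinear i v = generatorFun i v - generatorFun i 0 := rfl

theorem generatorFun_eq (i : Fin 13) :
    generatorFun i = fun v => generatorLinear i v + generatorFun i 0 := by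
  funext v
  simp [generatorLinear_apply]

theorem hasFDerivAt_generatorFun (i : Fin 13) (m : PointSpace) :
    HasFDerivAt (generatorFun i) (generatorLinear i) m := by
  conv in generatorFun i => rw [generatorFun_eq i]
  exact (generatorLinear i).hasFDerivAt.add_const _

variable {U : TopologicalSpace.Opens PointSpace}

theorem generator_apply (i : Fin 13) {m : PointSpace} (hm : m ∈ U) :
    generator U i m = generatorFun i m := SmoothVectorField.restrict_apply _ hm

theorem hasFDerivAt_generator (i : Fin 13) {m : PointSpace} (hm : m ∈ U) :
    HasFDerivAt (generator U i) (generatorLinear i) m :=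
  (hasFDerivAt_generatorFun i m).congr_of_eventuallyEq
    (Filter.eventually_of_mem (U.isOpen.mem_nhds hm) fun _ hn => generator_apply i hn)

/-- The system is in evolution form, so on its solution set the time derivatives can be eliminated
by substitution. -/
theorem eulerSystem_eq_zero {γ : ℝ} {j : JetSpace} (h : eulerSystem γ j = 0) :
    j.2 0 0 = -(j.1.2 0 * j.2 0 1 + j.1.2 1 * j.2 0 2 + j.1.2 2 * j.2 0 3) - j.2 3 1 / j.1.2 4 ∧
    j.2 1 0 = -(j.1.2 0 * j.2 1 1 + j.1.2 1 * j.2 1 2 + j.1.2 2 * j.2 1 3) - j.2 3 2 / j.1.2 4 ∧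
    j.2 2 0 = -(j.1.2 0 * j.2 2 1 + j.1.2 1 * j.2 2 2 + j.1.2 2 * j.2 2 3) - j.2 3 3 / j.1.2 4 ∧
    j.2 3 0 = -(j.1.2 0 * j.2 3 1 + j.1.2 1 * j.2 3 2 + j.1.2 2 * j.2 3 3) -
      γ * j.1.2 3 * (j.2 0 1 + j.2 1 2 + j.2 2 3) ∧
    j.2 4 0 = -(j.1.2 0 * j.2 4 1 + j.1.2 1 * j.2 4 2 + j.1.2 2 * j.2 4 3) -
      j.1.2 4 * (j.2 0 1 + j.2 1 2 + j.2 2 3) := by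
  have h0 := congrFun h 0
  have h1 := congrFun h 1
  have h2 := congrFun h 2
  have h3 := congrFun h 3
  have h4 := congrFun h 4
  simp [eulerSystem] at h0 h1 h2 h3 h4
  refine ⟨?_, ?_, ?_, ?_, ?_⟩
  · linear_combination h0
  · linear_combination h1
  · linear_combination h2
  · linear_combination h4
  · linear_combination h3

set_option maxHeartbeats 4000000 in
theorem isInfinitesimalSymmetry_generator (γ : ℝ) (hq : ∀ m ∈ U, m.2 4 ≠ 0) (i : Fin 13) :
    IsInfinitesimalSymmetry γ (generator U i) := by
  intro j hj h
  have hq' := hq _ hj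
  obtain ⟨h0, h1, h2, h3, h4⟩ := eulerSystem_eq_zero h
  rw [fderiv_eulerSystem γ hq', prolongation_eq (hasFDerivAt_generator i hj).differentiableAt,
    (hasFDerivAt_generator i hj).fderiv, generator_apply i hj]
  simp only [generatorLinear_apply]
  obtain ⟨⟨x, u⟩, J⟩ := j
  simp only at h0 h1 h2 h3 h4 hq'
  -- With 1/q replaced by a variable `r` subject only to `hqr`, and the time derivatives eliminated,
  -- every case becomes a polynomial identity.
  generalize hr : (u 4)⁻¹ = r
  have hqr : u 4 * r = 1 := by rw [← hr]; exact mul_inv_cancel₀ hq'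
  simp only [div_eq_mul_inv, hr] at h0 h1 h2
  simp only [linearizedEuler, totalDir, Fin.sum_univ_succ]
  simp only [div_eq_mul_inv, ← inv_pow, hr]
  clear h hj hq hr hq'
  funext k
  fin_cases k <;> dsimp <;>
    simp [Fin.castAdd, Fin.castLE, Fin.succ, h0, h1, h2, h3, h4] <;>
    fin_cases i <;> simp [generatorFun, h0, h1, h2] <;> first | ring1 | grind

theorem commutatorTable_rows {V : Type*} [AddCommGroup V] (X : Fin 13 → V) :
    commutatorTable X 0 = ![0, 0, 0, 0, 0, 0, 0, 0, X 0, -X 1, 0, X 2, 0] ∧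
    commutatorTable X 1 = ![0, 0, 0, 0, 0, 0, 0, 0, X 1, X 0, X 2, 0, 0] ∧
    commutatorTable X 2 = ![0, 0, 0, 0, 0, 0, 0, 0, X 2, 0, -X 1, -X 0, 0] ∧
    commutatorTable X 3 = ![0, 0, 0, 0, X 0, X 1, X 2, X 3, 0, 0, 0, 0, 0] ∧
    commutatorTable X 4 = ![0, 0, 0, -X 0, 0, 0, 0, -X 4, X 4, -X 5, 0, X 6, 0] ∧
    commutatorTable X 5 = ![0, 0, 0, -X 1, 0, 0, 0, -X 5, X 5, X 4, X 6, 0, 0] ∧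
    commutatorTable X 6 = ![0, 0, 0, -X 2, 0, 0, 0, -X 6, X 6, 0, -X 5, -X 4, 0] ∧
    commutatorTable X 7 = ![0, 0, 0, -X 3, X 4, X 5, X 6, 0, 0, 0, 0, 0, 0] ∧
    commutatorTable X 8 = ![-X 0, -X 1, -X 2, 0, -X 4, -X 5, -X 6, 0, 0, 0, 0, 0, 0] ∧
    commutatorTable X 9 = ![X 1, -X 0, 0, 0, X 5, -X 4, 0, 0, 0, 0, -X 11, X 10, 0] ∧
    commutatorTable X 10 = ![0, -X 2, X 1, 0, 0, -X 6, X 5, 0, 0, X 11, 0, -X 9, 0] ∧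
    commutatorTable X 11 = ![-X 2, 0, X 0, 0, -X 6, 0, X 4, 0, 0, -X 10, X 9, 0, 0] ∧
    commutatorTable X 12 = ![0, 0, 0, 0, 0, 0, 0, 0, 0, 0, 0, 0, 0] :=
  ⟨rfl, rfl, rfl, rfl, rfl, rfl, rfl, rfl, rfl, rfl, rfl, rfl, rfl⟩

set_option maxHeartbeats 4000000 in
-- The left side is DX_j(X_i) - DX_i(X_j), the commutator in coordinates; the derivatives are
-- constant because the fields are affine.
theorem generatorLinear_generatorFun_sub (i j : Fin 13) (m : PointSpace) :
    generatorLinear j (generatorFun i m) - generatorLinear i (generatorFun j m) =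
      commutatorTable generatorFun i j m := by
  obtain ⟨h0, h1, h2, h3, h4, h5, h6, h7, h8, h9, h10, h11, h12⟩ :=
    commutatorTable_rows generatorFun
  simp only [generatorLinear_apply]
  fin_cases i <;> fin_cases j <;>
    simp only [h0, h1, h2, h3, h4, h5, h6, h7, h8, h9, h10, h11, h12, Fin.zero_eta, Fin.mk_one,
      Fin.reduceFinMk] <;>
    simp [generatorFun, funext_iff, Fin.forall_fin_succ]

theorem commutatorTable_generator_apply (i j : Fin 13) {m : PointSpace} (hm : m ∈ U) :
    (commutatorTable (generator U) i j).1 m = commutatorTable generatorFun i j m := by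
  obtain ⟨h0, h1, h2, h3, h4, h5, h6, h7, h8, h9, h10, h11, h12⟩ :=
    commutatorTable_rows generatorFun
  obtain ⟨k0, k1, k2, k3, k4, k5, k6, k7, k8, k9, k10, k11, k12⟩ :=
    commutatorTable_rows (generator U)
  have hX : ∀ i, (generator U i).1 m = generatorFun i m := fun i => generator_apply i hm
  have hn : ∀ X : SmoothVectorField U, (-X).1 m = -X.1 m := fun _ => rfl
  have hz : (0 : SmoothVectorField U).1 m = 0 := rfl
  fin_cases i <;>
    simp only [h0, h1, h2, h3, h4, h5, h6, h7, h8, h9, h10, h11, h12, k0, k1, k2, k3, k4, k5, k6,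
      k7, k8, k9, k10, k11, k12, Fin.zero_eta, Fin.mk_one, Fin.reduceFinMk] <;>
    fin_cases j <;> simp [hX, hn, hz]

theorem generator_lie_generator (i j : Fin 13) :
    ⁅generator U i, generator U j⁆ = commutatorTable (generator U) i j :=
  SmoothVectorField.ext fun m hm => by
    rw [SmoothVectorField.bracket_apply _ _ hm, VectorField.lieBracket,
      (hasFDerivAt_generator i hm).fderiv, (hasFDerivAt_generator j hm).fderiv,
      generator_apply i hm, generator_apply j hm, generatorLinear_generatorFun_sub,
      commutatorTable_generator_apply i j hm]

theorem sum_smul_generator_apply (c : Fin 13 → ℝ) (m : PointSpace) :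
    (∑ i, c i • generator U i).1 m = ∑ i, c i • (generator U i).1 m :=
  map_sum (((LinearMap.proj m : (PointSpace → PointSpace) →ₗ[ℝ] PointSpace)).comp
    (smoothSubmodule U).subtype) (fun i => c i • generator U i) Finset.univ

/-- A linear relation on U holds for the values and the derivatives at one point. As the fields are
affine, it then holds on the whole space, where it can be evaluated at points outside U. -/
theorem linearIndependent_generator (hU : (U : Set PointSpace).Nonempty) :
    LinearIndependent ℝ (generator U) := by
  obtain ⟨m, hm⟩ := hU
  rw [Fintype.linearIndependent_iff]
  intro c hc
  have hsum := sum_smul_generator_apply (U := U) c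
  have h0 : ∑ i, c i • generatorFun i m = 0 := by
    rw [← (hsum m).trans (Finset.sum_congr rfl fun i _ => by rw [generator_apply i hm]), hc]
    rfl
  have h1 : ∀ v, ∑ i, c i • generatorLinear i v = 0 := fun v => by
    have := HasFDerivAt.fun_sum (u := Finset.univ)
      fun i _ => (hasFDerivAt_generator (U := U) i hm).const_smul (c i)
    have h2 := this.unique ((hasFDerivAt_const (0 : PointSpace) m).congr_of_eventuallyEq
      (Filter.Eventually.of_forall fun n => by
        have := hsum n
        rw [hc] at this
        exact this.symm))
    simpa using congrArg (fun L => L v) h2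
  have h2 : ∀ v, ∑ i, c i • generatorFun i v = 0 := fun v => by
    have h3 := h1 (v - m)
    simp only [map_sub, smul_sub, Finset.sum_sub_distrib] at h3
    have h4 : ∀ v, ∑ i, c i • generatorFun i v =
        ∑ i, c i • generatorLinear i v + ∑ i, c i • generatorFun i 0 := fun v => by
      rw [← Finset.sum_add_distrib]
      exact Finset.sum_congr rfl fun i _ => by rw [← smul_add, generatorLinear_apply]; simp
    rw [h4] at h0 ⊢
    rw [sub_eq_zero.1 h3, h0]
  -- The origin kills the translations and boosts; the unit points on the t, x, y and p axes then
  -- isolate the scalings and rotations.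
  have e0 := h2 0
  have e1 := h2 (Pi.single 0 1, 0)
  have e2 := h2 (Pi.single 1 1, 0)
  have e3 := h2 (Pi.single 2 1, 0)
  have e4 := h2 (0, Pi.single 3 1)
  simp [Fin.sum_univ_succ, generatorFun, Prod.ext_iff, funext_iff, Fin.forall_fin_succ]
    at e0 e1 e2 e3 e4
  intro i
  fin_cases i <;> simp <;> grind

/-! ### Free parameters of solution jets, and invariance in terms of material derivatives. -/

/-- Spatial gradients of the five dependent variables, given those of the velocity, the pressure and
the density. -/
def spatialGrad (V : Fin 3 → Fin 3 → ℝ) (P Q : Fin 3 → ℝ) : Fin 5 → Fin 3 → ℝ :=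
  ![V 0, V 1, V 2, P, Q]

/-- The material derivatives of the five dependent variables prescribed by the Euler equations. -/
noncomputable def materialRate (γ : ℝ) (m : PointSpace) (V : Fin 3 → Fin 3 → ℝ) (P : Fin 3 → ℝ) :
    Fin 5 → ℝ :=
  ![-(P 0 / m.2 4), -(P 1 / m.2 4), -(P 2 / m.2 4),
    -(γ * m.2 3 * (V 0 0 + V 1 1 + V 2 2)), -(m.2 4 * (V 0 0 + V 1 1 + V 2 2))]

/-- The first derivatives of the solutions of the Euler equations with given spatial gradients. -/
noncomputable def solutionJet (γ : ℝ) (m : PointSpace) (V : Fin 3 → Fin 3 → ℝ) (P Q : Fin 3 → ℝ)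
    (α : Fin 5) : Fin 4 → ℝ :=
  Fin.cons (materialRate γ m V P α - (m.2 0 * spatialGrad V P Q α 0 +
    m.2 1 * spatialGrad V P Q α 1 + m.2 2 * spatialGrad V P Q α 2)) (spatialGrad V P Q α)

/-- There is no restriction on `V`, `P`, `Q`: identities that hold on the solution set may be tested
at arbitrary gradients. -/
theorem eulerSystem_solutionJet (γ : ℝ) (m : PointSpace) (V : Fin 3 → Fin 3 → ℝ)
    (P Q : Fin 3 → ℝ) : eulerSystem γ (m, solutionJet γ m V P Q) = 0 := by
  have h0 : ∀ α, solutionJet γ m V P Q α 0 = materialRate γ m V P α -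
    (m.2 0 * spatialGrad V P Q α 0 + m.2 1 * spatialGrad V P Q α 1 +
      m.2 2 * spatialGrad V P Q α 2) := fun _ => rfl
  have h1 : ∀ α, solutionJet γ m V P Q α 1 = spatialGrad V P Q α 0 := fun _ => rfl
  have h2 : ∀ α, solutionJet γ m V P Q α 2 = spatialGrad V P Q α 1 := fun _ => rfl
  have h3 : ∀ α, solutionJet γ m V P Q α 3 = spatialGrad V P Q α 2 := fun _ => rfl
  funext k
  fin_cases k <;> simp [eulerSystem, h0, h1, h2, h3] <;> simp [materialRate, spatialGrad] <;> ring

/-- The components of a covector on the space of independent and dependent variables: in the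
direction of material transport, in the three spatial directions, and in the directions of the
velocity, the pressure and the density. -/
structure Gradient where
  mat : ℝ
  spc : Fin 3 → ℝ
  vel : Fin 3 → ℝ
  prs : ℝ
  den : ℝ

namespace Gradient

/-- The gradient `g - c • h`. -/
def subMul (g : Gradient) (c : ℝ) (h : Gradient) : Gradient :=
  ⟨g.mat - c * h.mat, fun i => g.spc i - c * h.spc i, fun i => g.vel i - c * h.vel i,
    g.prs - c * h.prs, g.den - c * h.den⟩

/-- The derivative along the trajectories of the gas. -/
noncomputable def along (g : Gradient) (γ p q : ℝ) (V : Fin 3 → Fin 3 → ℝ) (P : Fin 3 → ℝ) : ℝ :=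
  g.mat - (P 0 * g.vel 0 + P 1 * g.vel 1 + P 2 * g.vel 2) / q -
    (V 0 0 + V 1 1 + V 2 2) * (γ * p * g.prs + q * g.den)

/-- The total derivative in a spatial direction. -/
def total (g : Gradient) (V : Fin 3 → Fin 3 → ℝ) (P Q : Fin 3 → ℝ) (i : Fin 3) : ℝ :=
  g.spc i + (V 0 i * g.vel 0 + V 1 i * g.vel 1 + V 2 i * g.vel 2) + P i * g.prs + Q i * g.den

/-- The gradient of a linear functional at a point. -/
noncomputable def ofLinear (m : PointSpace) (l : PointSpace →L[ℝ] ℝ) : Gradient where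
  mat := l (Pi.single 0 1, 0) + (m.2 0 * l (Pi.single 1 1, 0) + m.2 1 * l (Pi.single 2 1, 0) +
    m.2 2 * l (Pi.single 3 1, 0))
  spc i := l (Pi.single i.succ 1, 0)
  vel i := l (0, Pi.single (i.castAdd 2) 1)
  prs := l (0, Pi.single 3 1)
  den := l (0, Pi.single 4 1)

end Gradient

/-- The infinitesimal criterion of invariance at a point, in terms of material derivatives, for the
data `τ`, `ζ k = ξ k - u k τ`, `η`, `π`, `ρ` of a vector field with values `e`, `a`, `b` of its
components along the velocity, the pressure and the density. -/
structure InvarianceCondition (γ p q : ℝ) (τ : Gradient) (ζ η : Fin 3 → Gradient) (π ρ : Gradient)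
    (e : Fin 3 → ℝ) (a b : ℝ) : Prop where
  momentum : ∀ (V : Fin 3 → Fin 3 → ℝ) (P Q : Fin 3 → ℝ) (i : Fin 3),
    (η i).along γ p q V P + P i / q * τ.along γ p q V P -
      (V i 0 * (ζ 0).along γ p q V P + V i 1 * (ζ 1).along γ p q V P +
        V i 2 * (ζ 2).along γ p q V P) +
      (π.total V P Q i + γ * p * (V 0 0 + V 1 1 + V 2 2) * τ.total V P Q i -
        (P 0 * (ζ 0).total V P Q i + P 1 * (ζ 1).total V P Q i + P 2 * (ζ 2).total V P Q i)) / q +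
      (e 0 * V i 0 + e 1 * V i 1 + e 2 * V i 2) - b * P i / q ^ 2 = 0
  mass : ∀ (V : Fin 3 → Fin 3 → ℝ) (P Q : Fin 3 → ℝ),
    ρ.along γ p q V P + q * (V 0 0 + V 1 1 + V 2 2) * τ.along γ p q V P -
      (Q 0 * (ζ 0).along γ p q V P + Q 1 * (ζ 1).along γ p q V P + Q 2 * (ζ 2).along γ p q V P) +
      (e 0 * Q 0 + e 1 * Q 1 + e 2 * Q 2) +
      q * ∑ i, ((η i).total V P Q i + P i / q * τ.total V P Q i -
        (V i 0 * (ζ 0).total V P Q i + V i 1 * (ζ 1).total V P Q i +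
          V i 2 * (ζ 2).total V P Q i)) + b * (V 0 0 + V 1 1 + V 2 2) = 0
  pressure : ∀ (V : Fin 3 → Fin 3 → ℝ) (P Q : Fin 3 → ℝ),
    π.along γ p q V P + γ * p * (V 0 0 + V 1 1 + V 2 2) * τ.along γ p q V P -
      (P 0 * (ζ 0).along γ p q V P + P 1 * (ζ 1).along γ p q V P + P 2 * (ζ 2).along γ p q V P) +
      (e 0 * P 0 + e 1 * P 1 + e 2 * P 2) +
      γ * p * ∑ i, ((η i).total V P Q i + P i / q * τ.total V P Q i -
        (V i 0 * (ζ 0).total V P Q i + V i 1 * (ζ 1).total V P Q i +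
          V i 2 * (ζ 2).total V P Q i)) + γ * a * (V 0 0 + V 1 1 + V 2 2) = 0

theorem Gradient.total_ofLinear (m : PointSpace) (l : PointSpace →L[ℝ] ℝ) (γ : ℝ)
    (V : Fin 3 → Fin 3 → ℝ) (P Q : Fin 3 → ℝ) (i : Fin 3) :
    (Gradient.ofLinear m l).total V P Q i = l (totalDir (solutionJet γ m V P Q) i.succ) := by
  have : totalDir (solutionJet γ m V P Q) i.succ = ((Pi.single i.succ 1, 0) : PointSpace) +
      (V 0 i • ((0, Pi.single 0 1) : PointSpace) + V 1 i • ((0, Pi.single 1 1) : PointSpace) +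
      V 2 i • ((0, Pi.single 2 1) : PointSpace)) + P i • ((0, Pi.single 3 1) : PointSpace) +
      Q i • ((0, Pi.single 4 1) : PointSpace) := by
    refine Prod.ext (by simp [totalDir]) (funext fun α => ?_)
    fin_cases α <;> simp [totalDir, solutionJet, spatialGrad]
  rw [this]
  simp only [map_add, map_smul, smul_eq_mul]
  simp [Gradient.total, Gradient.ofLinear, Fin.castAdd, Fin.castLE]

/-- In D_t + u D_x + v D_y + w D_z the convective parts of the jet cancel and only the rates
prescribed by the equations remain, which is why `Q` drops out of `along`. -/
theorem Gradient.along_ofLinear (m : PointSpace) (l : PointSpace →L[ℝ] ℝ) (γ : ℝ)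
    (V : Fin 3 → Fin 3 → ℝ) (P Q : Fin 3 → ℝ) :
    (Gradient.ofLinear m l).along γ (m.2 3) (m.2 4) V P =
      l (totalDir (solutionJet γ m V P Q) 0) + (m.2 0 * l (totalDir (solutionJet γ m V P Q) 1) +
      m.2 1 * l (totalDir (solutionJet γ m V P Q) 2) +
      m.2 2 * l (totalDir (solutionJet γ m V P Q) 3)) := by
  have h1 := Gradient.total_ofLinear m l γ V P Q 0
  have h2 := Gradient.total_ofLinear m l γ V P Q 1
  have h3 := Gradient.total_ofLinear m l γ V P Q 2
  have : ∀ c : Fin 5 → ℝ, ((Pi.single 0 1, c) : PointSpace) = ((Pi.single 0 1, 0) : PointSpace) +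
      (c 0 • ((0, Pi.single 0 1) : PointSpace) + c 1 • ((0, Pi.single 1 1) : PointSpace) +
      c 2 • ((0, Pi.single 2 1) : PointSpace)) + c 3 • ((0, Pi.single 3 1) : PointSpace) +
      c 4 • ((0, Pi.single 4 1) : PointSpace) := fun c => by
    refine Prod.ext (by simp) (funext fun α => ?_)
    fin_cases α <;> simp
  simp only [Fin.succ_zero_eq_one, Fin.succ_one_eq_two, Fin.reduceSucc] at h1 h2 h3
  rw [← h1, ← h2, ← h3, totalDir, this]
  simp only [map_add, map_smul, smul_eq_mul]
  simp [Gradient.along, Gradient.total, Gradient.ofLinear, Fin.castAdd, Fin.castLE, solutionJet,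
    materialRate, spatialGrad]
  ring

/-- The functional that reads off an independent variable. -/
noncomputable def indepCoord (k : Fin 4) : PointSpace →L[ℝ] ℝ :=
  (ContinuousLinearMap.proj k).comp (ContinuousLinearMap.fst ℝ (Fin 4 → ℝ) (Fin 5 → ℝ))

/-- The functional that reads off a dependent variable. -/
noncomputable def depCoord (α : Fin 5) : PointSpace →L[ℝ] ℝ :=
  (ContinuousLinearMap.proj α).comp (ContinuousLinearMap.snd ℝ (Fin 4 → ℝ) (Fin 5 → ℝ))

/-- The gradient of a linear functional of the values of a vector field with derivative `A`. -/
noncomputable def componentGradient (m : PointSpace) (A : PointSpace →L[ℝ] PointSpace)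
    (c : PointSpace →L[ℝ] ℝ) : Gradient := Gradient.ofLinear m (c.comp A)

theorem Gradient.along_subMul (g h : Gradient) (c γ p q : ℝ) (V : Fin 3 → Fin 3 → ℝ)
    (P : Fin 3 → ℝ) : (g.subMul c h).along γ p q V P = g.along γ p q V P - c * h.along γ p q V P := by
  simp only [Gradient.along, Gradient.subMul]
  ring

theorem Gradient.total_subMul (g h : Gradient) (c : ℝ) (V : Fin 3 → Fin 3 → ℝ)
    (P Q : Fin 3 → ℝ) (i : Fin 3) :
    (g.subMul c h).total V P Q i = g.total V P Q i - c * h.total V P Q i := by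
  simp only [Gradient.total, Gradient.subMul]
  ring

/-- Writing a time derivative as rate minus convection turns J_{α0} Dτ + ∑ J_{αk} Dξ_k into rate_α
Dτ + ∑ J_{αk} (Dξ_k - u_k Dτ), so the ξ_k enter only through ζ_k. The factor u_k is its value at `m`
and is not differentiated, as `subMul` expresses. -/
theorem IsInfinitesimalSymmetry.invarianceCondition {γ : ℝ}
    {X : SmoothVectorField U}
    (hX : IsInfinitesimalSymmetry γ X) {m : PointSpace} (hm : m ∈ U) (hq : m.2 4 ≠ 0) :
    InvarianceCondition γ (m.2 3) (m.2 4)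
      (componentGradient m (fderiv ℝ X m) (indepCoord 0))
      (fun k => (componentGradient m (fderiv ℝ X m) (indepCoord k.succ)).subMul
        (m.2 (k.castAdd 2)) (componentGradient m (fderiv ℝ X m) (indepCoord 0)))
      (fun k => componentGradient m (fderiv ℝ X m) (depCoord (k.castAdd 2)))
      (componentGradient m (fderiv ℝ X m) (depCoord 3))
      (componentGradient m (fderiv ℝ X m) (depCoord 4))
      (fun k => (X m).2 (k.castAdd 2)) ((X m).2 3) ((X m).2 4) := by
  have key : ∀ V P Q, linearizedEuler γ (m, solutionJet γ m V P Q)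
      (prolongation X (m, solutionJet γ m V P Q)) = 0 := fun V P Q => by
    rw [← fderiv_eulerSystem γ (j := (m, solutionJet γ m V P Q)) hq]
    exact hX _ hm (eulerSystem_solutionJet γ m V P Q)
  have hal : ∀ c V P Q, (componentGradient m (fderiv ℝ X m) c).along γ (m.2 3) (m.2 4) V P =
      c (fderiv ℝ X m (totalDir (solutionJet γ m V P Q) 0)) +
      (m.2 0 * c (fderiv ℝ X m (totalDir (solutionJet γ m V P Q) 1)) +
      m.2 1 * c (fderiv ℝ X m (totalDir (solutionJet γ m V P Q) 2)) +
      m.2 2 * c (fderiv ℝ X m (totalDir (solutionJet γ m V P Q) 3))) := fun c V P Q =>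
    Gradient.along_ofLinear m _ γ V P Q
  have htot : ∀ c V P Q i, (componentGradient m (fderiv ℝ X m) c).total V P Q i =
      c (fderiv ℝ X m (totalDir (solutionJet γ m V P Q) i.succ)) := fun c V P Q i =>
    Gradient.total_ofLinear m _ γ V P Q i
  have hi : ∀ k (w : PointSpace), indepCoord k w = w.1 k := fun _ _ => rfl
  have hd : ∀ k (w : PointSpace), depCoord k w = w.2 k := fun _ _ => rfl
  have h0 : ∀ V P Q α, solutionJet γ m V P Q α 0 = materialRate γ m V P α -
    (m.2 0 * spatialGrad V P Q α 0 + m.2 1 * spatialGrad V P Q α 1 +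
      m.2 2 * spatialGrad V P Q α 2) := fun _ _ _ _ => rfl
  have h1 : ∀ V P Q α, solutionJet γ m V P Q α 1 = spatialGrad V P Q α 0 := fun _ _ _ _ => rfl
  have h2 : ∀ V P Q α, solutionJet γ m V P Q α 2 = spatialGrad V P Q α 1 := fun _ _ _ _ => rfl
  have h3 : ∀ V P Q α, solutionJet γ m V P Q α 3 = spatialGrad V P Q α 2 := fun _ _ _ _ => rfl
  have hpr : ∀ V P Q, prolongation X (m, solutionJet γ m V P Q) = _ := fun V P Q =>
    prolongation_eq (j := (m, solutionJet γ m V P Q)) (X.differentiableAt hm)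
  simp only [hpr, linearizedEuler] at key
  refine ⟨fun V P Q i => ?_, fun V P Q => ?_, fun V P Q => ?_⟩
  · have k0 := congrFun (key V P Q) 0
    have k1 := congrFun (key V P Q) 1
    have k2 := congrFun (key V P Q) 2
    simp only [Gradient.along_subMul, Gradient.total_subMul, hal _ V P Q, htot, hi, hd]
    generalize fderiv ℝ X.1 m (totalDir (solutionJet γ m V P Q) 0) = w0 at *
    generalize hw1 : fderiv ℝ X.1 m (totalDir (solutionJet γ m V P Q) 1) = w1 at *
    generalize hw2 : fderiv ℝ X.1 m (totalDir (solutionJet γ m V P Q) 2) = w2 at *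
    generalize hw3 : fderiv ℝ X.1 m (totalDir (solutionJet γ m V P Q) 3) = w3 at *
    simp [Fin.sum_univ_succ, Fin.succ, Fin.castAdd, Fin.castLE, h0, h1, h2, h3, spatialGrad,
      materialRate, hw1, hw2, hw3] at k0 k1 k2
    fin_cases i
    · simp [Fin.succ, Fin.castAdd, Fin.castLE, hw1]
      linear_combination k0
    · simp [Fin.succ, Fin.castAdd, Fin.castLE, hw2]
      linear_combination k1
    · simp [Fin.succ, Fin.castAdd, Fin.castLE, hw3]
      linear_combination k2
  · have k0 := congrFun (key V P Q) 3
    simp only [Gradient.along_subMul, Gradient.total_subMul, hal _ V P Q, htot, hi, hd]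
    generalize fderiv ℝ X.1 m (totalDir (solutionJet γ m V P Q) 0) = w0 at *
    generalize hw1 : fderiv ℝ X.1 m (totalDir (solutionJet γ m V P Q) 1) = w1 at *
    generalize hw2 : fderiv ℝ X.1 m (totalDir (solutionJet γ m V P Q) 2) = w2 at *
    generalize hw3 : fderiv ℝ X.1 m (totalDir (solutionJet γ m V P Q) 3) = w3 at *
    simp [Fin.sum_univ_succ, Fin.succ, Fin.castAdd, Fin.castLE, h0, h1, h2, h3, spatialGrad,
      materialRate, hw1, hw2, hw3] at k0 ⊢
    linear_combination k0
  · have k0 := congrFun (key V P Q) 4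
    simp only [Gradient.along_subMul, Gradient.total_subMul, hal _ V P Q, htot, hi, hd]
    generalize fderiv ℝ X.1 m (totalDir (solutionJet γ m V P Q) 0) = w0 at *
    generalize hw1 : fderiv ℝ X.1 m (totalDir (solutionJet γ m V P Q) 1) = w1 at *
    generalize hw2 : fderiv ℝ X.1 m (totalDir (solutionJet γ m V P Q) 2) = w2 at *
    generalize hw3 : fderiv ℝ X.1 m (totalDir (solutionJet γ m V P Q) 3) = w3 at *
    simp [Fin.sum_univ_succ, Fin.succ, Fin.castAdd, Fin.castLE, h0, h1, h2, h3, spatialGrad,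
      materialRate, hw1, hw2, hw3] at k0 ⊢
    linear_combination k0

/-! ### Splitting the invariance condition by test gradients. -/

/-- The part of a gradient along the dependent variables. -/
def Gradient.fiber (g : Gradient) : Gradient := ⟨0, fun _ => 0, g.vel, g.prs, g.den⟩

namespace InvarianceCondition

variable {γ p q : ℝ} {τ : Gradient} {ζ η : Fin 3 → Gradient} {π ρ : Gradient} {e : Fin 3 → ℝ}
  {a b : ℝ}

/-- The condition F is a polynomial of degree at most two in the gradients, so (F(x) + F(-x) -
2F(0))/2 is its quadratic part; only the vertical derivatives of τ and ζ occur there. -/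
theorem momentum_quadratic (h : InvarianceCondition γ p q τ ζ η π ρ e a b)
    (V : Fin 3 → Fin 3 → ℝ) (P Q : Fin 3 → ℝ) (i : Fin 3) :
    P i / q * τ.fiber.along γ p q V P -
      (V i 0 * (ζ 0).fiber.along γ p q V P + V i 1 * (ζ 1).fiber.along γ p q V P +
        V i 2 * (ζ 2).fiber.along γ p q V P) +
      (γ * p * (V 0 0 + V 1 1 + V 2 2) * τ.fiber.total V P Q i -
        (P 0 * (ζ 0).fiber.total V P Q i + P 1 * (ζ 1).fiber.total V P Q i +
          P 2 * (ζ 2).fiber.total V P Q i)) / q = 0 := by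
  have h1 := h.momentum V P Q i
  have h2 := h.momentum (-V) (-P) (-Q) i
  have h3 := h.momentum 0 0 0 i
  simp only [Gradient.along, Gradient.total, Gradient.fiber, Pi.neg_apply, Pi.zero_apply] at *
  linear_combination (h1 + h2 - 2 * h3) / 2

theorem mass_quadratic (h : InvarianceCondition γ p q τ ζ η π ρ e a b)
    (V : Fin 3 → Fin 3 → ℝ) (P Q : Fin 3 → ℝ) :
    q * (V 0 0 + V 1 1 + V 2 2) * τ.fiber.along γ p q V P -
      (Q 0 * (ζ 0).fiber.along γ p q V P + Q 1 * (ζ 1).fiber.along γ p q V P +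
        Q 2 * (ζ 2).fiber.along γ p q V P) +
      q * ∑ i, (P i / q * τ.fiber.total V P Q i -
        (V i 0 * (ζ 0).fiber.total V P Q i + V i 1 * (ζ 1).fiber.total V P Q i +
          V i 2 * (ζ 2).fiber.total V P Q i)) = 0 := by
  have h1 := h.mass V P Q
  have h2 := h.mass (-V) (-P) (-Q)
  have h3 := h.mass 0 0 0
  simp only [Gradient.along, Gradient.total, Gradient.fiber, Pi.neg_apply, Pi.zero_apply,
    Fin.sum_univ_three] at *
  linear_combination (h1 + h2 - 2 * h3) / 2

/-- The symmetries of the Euler equations are fibre-preserving. -/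
theorem fiber_eq_zero (h : InvarianceCondition γ p q τ ζ η π ρ e a b) (hγ : γ ≠ 0) (hp : p ≠ 0)
    (hq : q ≠ 0) : ((∀ j, τ.vel j = 0) ∧ τ.prs = 0 ∧ τ.den = 0) ∧
      ∀ k, (∀ j, (ζ k).vel j = 0) ∧ (ζ k).prs = 0 ∧ (ζ k).den = 0 := by
  have hM := h.momentum_quadratic
  have hR := h.mass_quadratic
  simp only [Gradient.along, Gradient.total, Gradient.fiber, Fin.sum_univ_three] at hM hR
  -- Each test gradient below leaves a single unknown, once those already shown to vanish are
  -- dropped. The factor γp is cancelled for `τ.den` and `(ζ k).prs`.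
  have hτd : τ.den = 0 := by
    have := hM (fun i j => if i = 0 ∧ j = 0 then 1 else 0) 0 (fun i => if i = 1 then 1 else 0) 1
    simpa [hγ, hp, hq] using this
  have hζd : ∀ k, (ζ k).den = 0 := by
    have : ∀ k i, k ≠ i → (ζ k).den = 0 := fun k i hki => by
      have := hM 0 (fun l => if l = k then 1 else 0) (fun l => if l = i then 1 else 0) i
      clear hM hR
      fin_cases k <;> fin_cases i <;> simp_all
    intro k
    fin_cases k
    exacts [this 0 1 (by decide), this 1 0 (by decide), this 2 0 (by decide)]
  have hζp : ∀ k, (ζ k).prs = 0 := by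
    have : ∀ k i l, k ≠ i → i ≠ l → k ≠ l → (ζ k).prs = 0 := fun k i l hki hil hkl => by
      have := hM (fun i' j' => if i' = i ∧ j' = k ∨ i' = l ∧ j' = l then 1 else 0) 0 0 i
      clear hM hR
      fin_cases k <;> fin_cases i <;> fin_cases l <;> simp_all
    intro k
    fin_cases k
    exacts [this 0 1 2 (by decide) (by decide) (by decide),
      this 1 0 2 (by decide) (by decide) (by decide),
      this 2 0 1 (by decide) (by decide) (by decide)]
  have hτu : ∀ k, τ.vel k = 0 := fun k => by
    have := hM 0 (fun l => if l = k then 1 else 0) 0 k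
    have := hζp k
    clear hM hR
    fin_cases k <;> simp_all
  have hτp : τ.prs = 0 := by
    have := hR 0 (fun l => if l = 0 then 1 else 0) 0
    simpa [hq, hτu] using this
  refine ⟨⟨hτu, hτp, hτd⟩, fun k => ⟨fun j => ?_, hζp k, hζd k⟩⟩
  have : ∀ k i, k ≠ i → (ζ k).vel j = 0 := fun k i hki => by
    have := hM (fun i' j' => if i' = i ∧ j' = k then 1 else 0) (fun l => if l = j then 1 else 0) 0 i
    clear hM hR
    fin_cases k <;> fin_cases i <;> fin_cases j <;> simp_all
  fin_cases k
  exacts [this 0 1 (by decide), this 1 0 (by decide), this 2 0 (by decide)]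

/-- The determining equations of the symmetries of the Euler equations, for a vector field that
preserves the fibres. -/
theorem determining_equations (h : InvarianceCondition γ p q τ ζ η π ρ e a b) (hγ : γ ≠ 0)
    (hq : q ≠ 0) (hτ : (∀ j, τ.vel j = 0) ∧ τ.prs = 0 ∧ τ.den = 0)
    (hζ : ∀ k, (∀ j, (ζ k).vel j = 0) ∧ (ζ k).prs = 0 ∧ (ζ k).den = 0) :
    (∀ k, e k = (ζ k).mat) ∧ ((∀ j, π.vel j = 0) ∧ π.den = 0) ∧
    (∀ i k, q * ((η i).vel k + (ζ k).spc i) = if i = k then q * (τ.mat + π.prs) - b else 0) ∧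
    (∀ i, (η i).den = 0 → p * (q * (η i).prs - τ.spc i) = 0) ∧
    a - p * π.prs + p * (τ.mat + (η 0).vel 0 - (ζ 0).spc 0) = 0 ∧
    (∀ i, q * (η i).mat + π.spc i = 0) ∧
    ρ.mat + q * ((η 0).spc 0 + (η 1).spc 1 + (η 2).spc 2) = 0 ∧
    π.mat + γ * p * ((η 0).spc 0 + (η 1).spc 1 + (η 2).spc 2) = 0 := by
  obtain ⟨hτu, hτp, hτd⟩ := hτ
  have hζu : ∀ k j, (ζ k).vel j = 0 := fun k => (hζ k).1
  have hζp : ∀ k, (ζ k).prs = 0 := fun k => (hζ k).2.1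
  have hζd : ∀ k, (ζ k).den = 0 := fun k => (hζ k).2.2
  have hM := h.momentum
  have hR := h.mass
  have hP := h.pressure
  simp only [Gradient.along, Gradient.total, Fin.sum_univ_three, hτu, hτp, hτd, hζu, hζp, hζd,
    mul_zero, add_zero, zero_div, sub_zero] at hM hR hP
  -- Without vertical derivatives of τ and ζ the conditions are affine in the gradients: zero
  -- gradients give the constant terms, and single unit entries give the coefficients.
  have hM0 : ∀ i, (η i).mat + π.spc i / q = 0 := fun i => by simpa using hM 0 0 0 i
  have hMC : ∀ i, q * (η i).mat + π.spc i = 0 := fun i => by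
    have := hM0 i
    field_simp at this
    linarith
  have hRC : ρ.mat + q * ((η 0).spc 0 + (η 1).spc 1 + (η 2).spc 2) = 0 := by
    simpa using hR 0 0 0
  have hPC : π.mat + γ * p * ((η 0).spc 0 + (η 1).spc 1 + (η 2).spc 2) = 0 := by
    simpa using hP 0 0 0
  have hπd : π.den = 0 := by
    have h1 := hM 0 0 (fun l => if l = 0 then 1 else 0) 0
    have h2 := hM0 0
    simp at h1
    field_simp at h1 h2
    linarith
  have hηuk : ∀ i k, q * ((η i).vel k + (ζ k).spc i) =
      if i = k then q * (τ.mat + π.prs) - b else 0 := fun i k => by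
    have h1 := hM 0 (fun l => if l = k then 1 else 0) 0 i
    have h2 := hM0 i
    fin_cases i <;> fin_cases k <;> simp at h1 h2 ⊢ <;> field_simp at h1 h2 <;> grind
  have he : ∀ k, e k = (ζ k).mat := by
    have : ∀ k i, k ≠ i → e k = (ζ k).mat := fun k i hki => by
      have h1 := hM (fun i' j' => if i' = i ∧ j' = k then 1 else 0) 0 0 i
      have h2 := hM0 i
      fin_cases k <;> fin_cases i <;> simp at h1 h2 hki ⊢ <;> linarith
    intro k
    fin_cases k
    exacts [this 0 1 (by decide), this 1 0 (by decide), this 2 0 (by decide)]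
  have hπu : ∀ k, π.vel k = 0 := by
    have : ∀ k i, k ≠ i → π.vel k = 0 := fun k i hki => by
      have h1 := hM (fun i' j' => if i' = k ∧ j' = i then 1 else 0) 0 0 i
      have h2 := hM0 i
      fin_cases k <;> fin_cases i <;> simp at h1 h2 hki ⊢ <;> field_simp at h1 h2 <;> linarith
    intro k
    fin_cases k
    exacts [this 0 1 (by decide), this 1 0 (by decide), this 2 0 (by decide)]
  -- The coefficient of `V k k` with k ≠ i also contains `(η i).den`, whose vanishing is not
  -- available pointwise; it follows later from the formula for η (`dq_η`). The factor p is kept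
  -- because p may vanish at the point.
  have hηp : ∀ i, (η i).den = 0 → p * (q * (η i).prs - τ.spc i) = 0 := by
    have : ∀ i k, i ≠ k → (η i).den = 0 → p * (q * (η i).prs - τ.spc i) = 0 := fun i k hik hd => by
      have h1 := hM (fun i' j' => if i' = k ∧ j' = k then 1 else 0) 0 0 i
      have h2 := hM0 i
      rw [hd] at h1
      refine mul_left_cancel₀ hγ ?_
      fin_cases i <;> fin_cases k <;> simp [hπu] at h1 h2 hik ⊢ <;> field_simp at h1 h2 <;> grind
    intro i
    fin_cases i
    exacts [this 0 1 (by decide), this 1 0 (by decide), this 2 0 (by decide)]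
  refine ⟨he, ⟨hπu, hπd⟩, hηuk, hηp, ?_, hMC, hRC, hPC⟩
  have h1 := hP (fun i' j' => if i' = 0 ∧ j' = 0 then 1 else 0) 0 0
  simp [hπd] at h1
  refine mul_left_cancel₀ hγ ?_
  linear_combination h1 - hPC

end InvarianceCondition

/-! ### Smooth functions on U as an algebra with commuting derivations. -/

theorem extend_val_apply (f : U → ℝ) (m : U) : Function.extend Subtype.val f 0 (m : PointSpace) = f m :=
  Subtype.val_injective.extend_apply f 0 m

theorem contDiffOn_extend_val {F : PointSpace → ℝ} (hF : ContDiffOn ℝ ∞ F U) {f : U → ℝ}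
    (h : ∀ m : U, f m = F m) : ContDiffOn ℝ ∞ (Function.extend Subtype.val f 0) U :=
  hF.congr fun m hm => (extend_val_apply f ⟨m, hm⟩).trans (h ⟨m, hm⟩)

/-- The algebra of smooth functions on the open set `U`. -/
noncomputable def smoothFunctions (U : TopologicalSpace.Opens PointSpace) :
    Subalgebra ℝ (U → ℝ) where
  carrier := {f | ContDiffOn ℝ ∞ (Function.extend Subtype.val f 0) U}
  mul_mem' := fun {f g} hf hg => contDiffOn_extend_val (ContDiffOn.mul hf hg) fun m => by
    simp
  add_mem' := fun {f g} hf hg => contDiffOn_extend_val (ContDiffOn.add hf hg) fun m => by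
    simp
  algebraMap_mem' := fun c => contDiffOn_extend_val (contDiffOn_const (c := c)) fun m => rfl

namespace smoothFunctions

/-- The extension by zero of a smooth function on `U`. -/
noncomputable def ext (f : smoothFunctions U) : PointSpace → ℝ := Function.extend Subtype.val f.1 0

theorem ext_apply (f : smoothFunctions U) (m : U) : ext f m = f.1 m := extend_val_apply _ _

theorem contDiffAt_ext (f : smoothFunctions U) {m : PointSpace} (hm : m ∈ U) :
    ContDiffAt ℝ ∞ (ext f) m := ContDiffOn.contDiffAt f.2 (U.isOpen.mem_nhds hm)

theorem differentiableAt_ext (f : smoothFunctions U) {m : PointSpace} (hm : m ∈ U) :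
    DifferentiableAt ℝ (ext f) m := (contDiffAt_ext f hm).differentiableAt (by simp)

/-- The restriction to `U` of a function that is smooth on `U`. -/
noncomputable def restrict {F : PointSpace → ℝ} (hF : ContDiffOn ℝ ∞ F U) : smoothFunctions U :=
  ⟨fun m => F m, contDiffOn_extend_val hF fun _ => rfl⟩

theorem restrict_apply {F : PointSpace → ℝ} (hF : ContDiffOn ℝ ∞ F U) (m : U) :
    (restrict hF).1 m = F m := rfl

theorem eventuallyEq_ext {F : PointSpace → ℝ} {f : smoothFunctions U}
    (h : ∀ m : U, f.1 m = F m) {m : PointSpace} (hm : m ∈ U) : ext f =ᶠ[nhds m] F :=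
  Filter.eventually_of_mem (U.isOpen.mem_nhds hm) fun n hn => (ext_apply f ⟨n, hn⟩).trans (h ⟨n, hn⟩)

theorem contDiffOn_fderiv_ext (f : smoothFunctions U) (v : PointSpace) :
    ContDiffOn ℝ ∞ (fun m => fderiv ℝ (ext f) m v) U := fun _ hm =>
  (((contDiffAt_ext f hm).fderiv_right (m := ∞) (by simp)).clm_apply
    contDiffAt_const).contDiffWithinAt

/-- The derivative in the direction `v`, as a derivation of the algebra of smooth functions. -/
noncomputable def pderiv (v : PointSpace) : Derivation ℝ (smoothFunctions U) (smoothFunctions U) :=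
  Derivation.mk'
    { toFun := fun f => restrict (contDiffOn_fderiv_ext f v)
      map_add' := fun f g => Subtype.ext (funext fun m => by
        change fderiv ℝ (ext (f + g)) m v = fderiv ℝ (ext f) m v + fderiv ℝ (ext g) m v
        rw [(eventuallyEq_ext (F := ext f + ext g) (fun n => by
          simp [ext_apply]) m.2).fderiv_eq, fderiv_add (differentiableAt_ext f m.2)
            (differentiableAt_ext g m.2)]
        rfl)
      map_smul' := fun c f => Subtype.ext (funext fun m => by
        change fderiv ℝ (ext (c • f)) m v = c • fderiv ℝ (ext f) m v
        rw [(eventuallyEq_ext (F := c • ext f) (fun n => by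
          simp [ext_apply]) m.2).fderiv_eq, fderiv_const_smul (differentiableAt_ext f m.2)]
        rfl) }
    fun f g => Subtype.ext (funext fun m => by
      change fderiv ℝ (ext (f * g)) m v = f.1 m * fderiv ℝ (ext g) m v +
        g.1 m * fderiv ℝ (ext f) m v
      rw [(eventuallyEq_ext (F := ext f * ext g) (fun n => by
          simp [ext_apply]) m.2).fderiv_eq, fderiv_mul (differentiableAt_ext f m.2)
            (differentiableAt_ext g m.2)]
      simp [ext_apply])

theorem pderiv_apply (v : PointSpace) (f : smoothFunctions U) (m : U) :
    (pderiv v f).1 m = fderiv ℝ (ext f) m v := rfl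

theorem pderiv_restrict {F : PointSpace → ℝ} (hF : ContDiffOn ℝ ∞ F U) (v : PointSpace) (m : U) :
    (pderiv v (restrict hF)).1 m = fderiv ℝ F m v := by
  rw [pderiv_apply, (eventuallyEq_ext (fun n => restrict_apply hF n) m.2).fderiv_eq]

theorem pderiv_comm (v w : PointSpace) (f : smoothFunctions U) :
    pderiv v (pderiv w f) = pderiv w (pderiv v f) := by
  have key : ∀ (v w : PointSpace) (m : U), (pderiv v (pderiv w f)).1 m =
      fderiv ℝ (fderiv ℝ (ext f)) m v w := fun v w m => by
    rw [pderiv_apply, (eventuallyEq_ext (F := fun n => fderiv ℝ (ext f) n w)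
      (fun n => pderiv_apply w f n) m.2).fderiv_eq]
    have := ((contDiffAt_ext f m.2).fderiv_right (m := ∞) (by simp)).differentiableAt (by simp)
    rw [fderiv_clm_apply this (differentiableAt_const _)]
    simp
  refine Subtype.ext (funext fun m => ?_)
  rw [key, key]
  exact ((contDiffAt_ext f m.2).isSymmSndFDerivAt (by
    simpa using (WithTop.coe_le_coe.2 le_top : ((2 : ℕ∞) : WithTop ℕ∞) ≤ ∞))) v w

/-- A smooth function on a connected open set with vanishing partial derivatives is constant. -/
theorem exists_const (hU : IsConnected (U : Set PointSpace)) {f : smoothFunctions U}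
    (h1 : ∀ k, pderiv (Pi.single k 1, 0) f = 0) (h2 : ∀ α, pderiv (0, Pi.single α 1) f = 0) :
    ∃ c : ℝ, ∀ m, f.1 m = c := by
  obtain ⟨c, hc⟩ := U.isOpen.exists_is_const_of_fderiv_eq_zero hU.isPreconnected
    (f := ext f) (fun m hm => (differentiableAt_ext f hm).differentiableWithinAt)
    (fun m hm => by
      refine ContinuousLinearMap.ext fun v => ?_
      have hv : v = ∑ k, v.1 k • ((Pi.single k 1, 0) : PointSpace) +
          ∑ α, v.2 α • ((0, Pi.single α 1) : PointSpace) := by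
        refine Prod.ext (funext fun k => ?_) (funext fun k => ?_) <;>
        simp [Prod.fst_sum, Prod.snd_sum, Finset.sum_apply, Pi.single_apply]
      have e1 : ∀ k, fderiv ℝ (ext f) m (Pi.single k 1, 0) = 0 := fun k =>
        congrFun (congrArg Subtype.val (h1 k)) ⟨m, hm⟩
      have e2 : ∀ α, fderiv ℝ (ext f) m (0, Pi.single α 1) = 0 := fun α =>
        congrFun (congrArg Subtype.val (h2 α)) ⟨m, hm⟩
      rw [hv]
      simp only [map_add, map_sum, map_smul, e1, e2]
      simp)
  exact ⟨c, fun m => (ext_apply f m).symm.trans (hc m m.2)⟩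

end smoothFunctions

/-! ### Differential consequences of the determining equations. -/

/-- A commutative algebra with commuting derivations that behave like the partial derivatives in
`t`, `x, y, z`, `u, v, w`, `p` and `q`, with elements that behave like the coordinates. -/
structure GasCalculus (A : Type*) [CommRing A] [Algebra ℝ A] where
  dt : Derivation ℝ A A
  dx : Fin 3 → Derivation ℝ A A
  du : Fin 3 → Derivation ℝ A A
  dp : Derivation ℝ A A
  dq : Derivation ℝ A A
  u : Fin 3 → A
  p : A
  q : A
  dx_dt : ∀ i f, dx i (dt f) = dt (dx i f)
  dx_dx : ∀ i j f, dx i (dx j f) = dx j (dx i f)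
  du_dt : ∀ i f, du i (dt f) = dt (du i f)
  du_dx : ∀ i j f, du i (dx j f) = dx j (du i f)
  dp_dt : ∀ f, dp (dt f) = dt (dp f)
  dp_dx : ∀ j f, dp (dx j f) = dx j (dp f)
  dp_du : ∀ j f, dp (du j f) = du j (dp f)
  dq_dt : ∀ f, dq (dt f) = dt (dq f)
  dq_dx : ∀ j f, dq (dx j f) = dx j (dq f)
  dq_dp : ∀ f, dq (dp f) = dp (dq f)
  dt_u : ∀ j, dt (u j) = 0
  dx_u : ∀ i j, dx i (u j) = 0
  du_u : ∀ i j, du i (u j) = if i = j then 1 else 0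
  dp_u : ∀ j, dp (u j) = 0
  dq_u : ∀ j, dq (u j) = 0
  dp_p : dp p = 1
  dx_q : ∀ i, dx i q = 0
  dt_q : dt q = 0
  dq_q : dq q = 1
  eq_zero_of_p_mul : ∀ {f}, p * f = 0 → f = 0
  eq_zero_of_q_mul : ∀ {f}, q * f = 0 → f = 0

namespace GasCalculus

variable {A : Type*} [CommRing A] [Algebra ℝ A] (C : GasCalculus A)

/-- The derivative along the trajectories of the gas. -/
def mat (f : A) : A := C.dt f + (C.u 0 * C.dx 0 f + C.u 1 * C.dx 1 f + C.u 2 * C.dx 2 f)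

/-- The determining equations of the symmetries of the Euler equations. -/
structure DeterminingEquations (γ : ℝ) (τ : A) (ξ η : Fin 3 → A) (π ρ : A) : Prop where
  du_τ : ∀ j, C.du j τ = 0
  dp_τ : C.dp τ = 0
  dq_τ : C.dq τ = 0
  du_ξ : ∀ j k, C.du j (ξ k) = 0
  dp_ξ : ∀ k, C.dp (ξ k) = 0
  dq_ξ : ∀ k, C.dq (ξ k) = 0
  η_eq : ∀ k, η k = C.mat (ξ k) - C.u k * C.mat τ
  du_π : ∀ j, C.du j π = 0
  dq_π : C.dq π = 0
  du_η : ∀ i k, C.q * (C.du k (η i) + (C.dx i (ξ k) - C.u k * C.dx i τ)) =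
    if i = k then C.q * (C.mat τ + C.dp π) - ρ else 0
  dp_η : (∀ i, C.dq (η i) = 0) → ∀ i, C.p * (C.q * C.dp (η i) - C.dx i τ) = 0
  π_eq : π - C.p * C.dp π +
    C.p * (C.mat τ + C.du 0 (η 0) - (C.dx 0 (ξ 0) - C.u 0 * C.dx 0 τ)) = 0
  mat_η : ∀ i, C.q * C.mat (η i) + C.dx i π = 0
  mat_ρ : C.mat ρ + C.q * (C.dx 0 (η 0) + C.dx 1 (η 1) + C.dx 2 (η 2)) = 0
  mat_π : C.mat π + algebraMap ℝ A γ * C.p * (C.dx 0 (η 0) + C.dx 1 (η 1) + C.dx 2 (η 2)) = 0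

namespace DeterminingEquations

variable {C} {γ : ℝ} {τ : A} {ξ η : Fin 3 → A} {π ρ : A}

theorem dq_η (h : C.DeterminingEquations γ τ ξ η π ρ) (i : Fin 3) : C.dq (η i) = 0 := by
  simp [h.η_eq, mat, C.dq_dt, C.dq_dx, C.dq_u, h.dq_τ, h.dq_ξ]

theorem dp_η_eq_zero (h : C.DeterminingEquations γ τ ξ η π ρ) (i : Fin 3) : C.dp (η i) = 0 := by
  simp [h.η_eq, mat, C.dp_dt, C.dp_dx, C.dp_u, h.dp_τ, h.dp_ξ]

/-- By the formula for η in terms of τ and ξ, η is independent of p and q, so only the τ term of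
`dp_η` survives. -/
theorem dx_τ (h : C.DeterminingEquations γ τ ξ η π ρ) (i : Fin 3) : C.dx i τ = 0 := by
  have := C.eq_zero_of_p_mul (h.dp_η h.dq_η i)
  simpa [h.dp_η_eq_zero] using this

theorem mat_τ (h : C.DeterminingEquations γ τ ξ η π ρ) : C.mat τ = C.dt τ := by
  simp [mat, h.dx_τ]

theorem du_η_eq (h : C.DeterminingEquations γ τ ξ η π ρ) (i j : Fin 3) :
    C.du j (η i) = C.dx j (ξ i) - if j = i then C.dt τ else 0 := by
  rw [h.η_eq, h.mat_τ]
  fin_cases j <;> simp [mat, C.du_dt, C.du_dx, C.du_u, h.du_τ, h.du_ξ]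

theorem π_eq_mul (h : C.DeterminingEquations γ τ ξ η π ρ) : π = C.p * C.dp π := by
  have := h.π_eq
  rw [h.du_η_eq, h.mat_τ, h.dx_τ, if_pos rfl] at this
  linear_combination this

/-- In q (mat η_i) + ∂_i π = 0 only the explicit factor q depends on the density; apply ∂_q. -/
theorem mat_η_eq_zero (h : C.DeterminingEquations γ τ ξ η π ρ) (i : Fin 3) :
    C.mat (η i) = 0 := by
  have := congrArg C.dq (h.mat_η i)
  simpa [mat, C.dq_q, C.dq_dt, C.dq_dx, C.dq_u, h.dq_η, h.dq_π] using this

theorem dx_π (h : C.DeterminingEquations γ τ ξ η π ρ) (i : Fin 3) : C.dx i π = 0 := by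
  simpa [h.mat_η_eq_zero] using h.mat_η i

theorem du_mat_η (h : C.DeterminingEquations γ τ ξ η π ρ) (i j : Fin 3) :
    C.dt (C.du j (η i)) + C.dx j (η i) + (C.u 0 * C.dx 0 (C.du j (η i)) +
      C.u 1 * C.dx 1 (C.du j (η i)) + C.u 2 * C.dx 2 (C.du j (η i))) = 0 := by
  have := congrArg (C.du j) (h.mat_η_eq_zero i)
  fin_cases j <;> simp [mat, C.du_dt, C.du_dx, C.du_u] at this ⊢ <;> linear_combination this

theorem dx_du_η (h : C.DeterminingEquations γ τ ξ η π ρ) (i j k : Fin 3) :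
    C.dx k (C.du j (η i)) = C.dx k (C.dx j (ξ i)) := by
  rw [h.du_η_eq]
  split_ifs <;> simp [C.dx_dt, h.dx_τ]

theorem du_du_η (h : C.DeterminingEquations γ τ ξ η π ρ) (i j k : Fin 3) :
    C.du k (C.du j (η i)) = 0 := by
  rw [h.du_η_eq]
  split_ifs <;> simp [C.du_dt, C.du_dx, h.du_τ, h.du_ξ]

/-- The u_k-derivative of `du_mat_η` is ∂_{x_j}∂_{u_k} η_i + ∂_{x_k}∂_{u_j} η_i = 0, and both terms
equal ∂_{x_j}∂_{x_k} ξ_i. -/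
theorem dx_dx_ξ (h : C.DeterminingEquations γ τ ξ η π ρ) (i j k : Fin 3) :
    C.dx k (C.dx j (ξ i)) = 0 := by
  have h1 := congrArg (C.du k) (h.du_mat_η i j)
  have h2 := h.dx_du_η i k j
  rw [C.dx_dx] at h2
  have h3 : (2 : ℝ) • C.dx k (C.dx j (ξ i)) = 0 := by
    rw [two_smul]
    fin_cases k <;> simp [C.du_dt, C.du_dx, C.du_u, h.du_du_η, h.dx_du_η, h.du_ξ] at h1 h2 ⊢ <;>
      linear_combination h1 - h2
  simpa using congrArg ((2⁻¹ : ℝ) • ·) h3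

theorem dx_η (h : C.DeterminingEquations γ τ ξ η π ρ) (i j : Fin 3) :
    C.dx j (η i) = C.dt (C.dx j (ξ i)) := by
  simp [h.η_eq, mat, C.dx_dt, C.dx_u, h.dx_dx_ξ, h.dx_τ]

theorem two_mul_dt_dx_ξ (h : C.DeterminingEquations γ τ ξ η π ρ) (i j : Fin 3) :
    2 * C.dt (C.dx j (ξ i)) = if j = i then C.dt (C.dt τ) else 0 := by
  have h1 := h.du_mat_η i j
  rw [h.dx_du_η, h.dx_du_η, h.dx_du_η, h.dx_η, h.du_η_eq] at h1
  split_ifs at h1 ⊢ <;> simp [h.dx_dx_ξ] at h1 <;> linear_combination h1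

theorem dt_dp_π (h : C.DeterminingEquations γ τ ξ η π ρ) :
    C.dt (C.dp π) + algebraMap ℝ A γ * (C.dx 0 (η 0) + C.dx 1 (η 1) + C.dx 2 (η 2)) = 0 := by
  have := congrArg C.dp h.mat_π
  simp [mat, C.dp_dt, C.dp_dx, C.dp_p, h.dx_π, h.dp_η_eq_zero] at this
  linear_combination this

theorem ρ_eq (h : C.DeterminingEquations γ τ ξ η π ρ) (i : Fin 3) :
    ρ = C.q * (2 * C.dt τ + C.dp π - 2 * C.dx i (ξ i)) := by
  have := h.du_η i i
  rw [h.du_η_eq, h.mat_τ, h.dx_τ, if_pos rfl, if_pos rfl] at this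
  linear_combination this

theorem dx_dp_π (h : C.DeterminingEquations γ τ ξ η π ρ) (i : Fin 3) : C.dx i (C.dp π) = 0 := by
  rw [← C.dp_dx, h.dx_π, map_zero]

/-- Put s = τ_tt. Then ∂_t∂_i ξ_i = s/2 for each i, so div η = 3s/2. The pressure equation gives ∂_t
π_p = -3γs/2, and the mass equation with ρ = q(2τ_t + π_p - 2∂_1 ξ_1) gives 5s/2 + ∂_t π_p = 0.
Hence (5 - 3γ)s = 0. -/
theorem dt_dt_τ (h : C.DeterminingEquations γ τ ξ η π ρ) (hγ : γ ≠ 5 / 3) :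
    C.dt (C.dt τ) = 0 := by
  have h1 := h.two_mul_dt_dx_ξ
  have h2 := h.mat_ρ
  have h3 := h.dt_dp_π
  have e0 := h1 0 0
  have e1 := h1 1 1
  have e2 := h1 2 2
  simp only [if_true] at e0 e1 e2
  rw [h.ρ_eq 0, two_mul, two_mul] at h2
  simp [mat, C.dt_q, C.dx_q, C.dx_dt, h.dx_τ, h.dx_dp_π, h.dx_dx_ξ, h.dx_η] at h2 h3
  have h4 := C.eq_zero_of_q_mul (f := 2 * (2 * C.dt (C.dt τ) + C.dt (C.dp π) -
    2 * C.dt (C.dx 0 (ξ 0)) + (C.dt (C.dx 0 (ξ 0)) + C.dt (C.dx 1 (ξ 1)) +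
      C.dt (C.dx 2 (ξ 2))))) (by linear_combination 2 * h2)
  have h5 : (5 - 3 * γ) • C.dt (C.dt τ) = 0 := by
    rw [Algebra.smul_def, map_sub, map_mul, map_ofNat, map_ofNat]
    linear_combination h4 - 2 * h3 + 2 * e0 + (algebraMap ℝ A γ - 1) * (e0 + e1 + e2)
  have h6 : 5 - 3 * γ ≠ 0 := fun h => hγ (by linarith)
  simpa [smul_smul, h6] using congrArg ((5 - 3 * γ)⁻¹ • ·) h5

theorem dt_dx_ξ (h : C.DeterminingEquations γ τ ξ η π ρ) (hγ : γ ≠ 5 / 3) (i j : Fin 3) :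
    C.dt (C.dx j (ξ i)) = 0 := by
  have h1 := h.two_mul_dt_dx_ξ i j
  rw [h.dt_dt_τ hγ, ite_self] at h1
  have h3 : (2 : ℝ) • C.dt (C.dx j (ξ i)) = 0 := by rw [two_smul, ← two_mul, h1]
  simpa using congrArg ((2⁻¹ : ℝ) • ·) h3

theorem dt_dt_ξ (h : C.DeterminingEquations γ τ ξ η π ρ) (hγ : γ ≠ 5 / 3) (i : Fin 3) :
    C.dt (C.dt (ξ i)) = 0 := by
  have := h.mat_η_eq_zero i
  rw [mat, h.dx_η, h.dx_η, h.dx_η, h.η_eq, h.mat_τ] at this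
  simpa [mat, C.dt_u, h.dt_dx_ξ hγ, h.dt_dt_τ hγ] using this

theorem dt_dp_π_eq_zero (h : C.DeterminingEquations γ τ ξ η π ρ) (hγ : γ ≠ 5 / 3) :
    C.dt (C.dp π) = 0 := by
  simpa [h.dx_η, h.dt_dx_ξ hγ] using h.dt_dp_π

theorem dp_dp_π (h : C.DeterminingEquations γ τ ξ η π ρ) : C.dp (C.dp π) = 0 := by
  have := congrArg C.dp h.π_eq_mul
  rw [Derivation.leibniz, C.dp_p, smul_eq_mul, smul_eq_mul, mul_one] at this
  exact C.eq_zero_of_p_mul (by linear_combination -this)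

/-- Together with `dx_ξ_self` this makes the spatial part of ξ an infinitesimal similarity: off the
diagonal the equation for ∂_{u_k} η_i is the Killing equation. -/
theorem dx_ξ_add (h : C.DeterminingEquations γ τ ξ η π ρ) {i k : Fin 3} (hik : i ≠ k) :
    C.dx k (ξ i) + C.dx i (ξ k) = 0 := by
  have := h.du_η i k
  rw [h.du_η_eq, h.dx_τ, if_neg hik, if_neg hik.symm] at this
  exact C.eq_zero_of_q_mul (by linear_combination this)

theorem dx_ξ_self (h : C.DeterminingEquations γ τ ξ η π ρ) (i k : Fin 3) :
    C.dx i (ξ i) = C.dx k (ξ k) := by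
  have h1 : (2 : ℝ) • (C.dx i (ξ i) - C.dx k (ξ k)) = 0 := by
    rw [two_smul]
    exact C.eq_zero_of_q_mul (by linear_combination h.ρ_eq i - h.ρ_eq k)
  exact sub_eq_zero.1 (by simpa using congrArg ((2⁻¹ : ℝ) • ·) h1)

theorem du_dp_π (h : C.DeterminingEquations γ τ ξ η π ρ) (i : Fin 3) : C.du i (C.dp π) = 0 := by
  rw [← C.dp_du, h.du_π, map_zero]

theorem dq_dp_π (h : C.DeterminingEquations γ τ ξ η π ρ) : C.dq (C.dp π) = 0 := by
  rw [C.dq_dp, h.dq_π, map_zero]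

end DeterminingEquations

end GasCalculus

/-! ### Partial derivatives on U as a model of the calculus, and affine functions. -/

namespace smoothFunctions

/-- The image of a smooth vector field under a linear functional of its values. -/
noncomputable def component (c : PointSpace →L[ℝ] ℝ) (X : SmoothVectorField U) :
    smoothFunctions U :=
  restrict (F := fun m => c (X m)) (c.contDiff.comp_contDiffOn X.contDiffOn)

theorem pderiv_component (c : PointSpace →L[ℝ] ℝ) (X : SmoothVectorField U) (v : PointSpace)
    (m : U) : (pderiv v (component c X)).1 m = c (fderiv ℝ X m v) :=
  (pderiv_restrict _ v m).trans (congrArg (fun L => L v)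
    (c.hasFDerivAt.comp (m : PointSpace) (X.differentiableAt m.2).hasFDerivAt).fderiv)

/-- A linear functional as a smooth function on `U`. -/
noncomputable def linear (U : TopologicalSpace.Opens PointSpace) (c : PointSpace →L[ℝ] ℝ) :
    smoothFunctions U :=
  restrict (F := c) c.contDiff.contDiffOn

theorem pderiv_linear (c : PointSpace →L[ℝ] ℝ) (v : PointSpace) :
    pderiv v (linear U c) = algebraMap ℝ _ (c v) :=
  Subtype.ext (funext fun m => (pderiv_restrict _ v m).trans (by rw [c.fderiv]; rfl))

theorem ext_iff' {f g : smoothFunctions U} : f = g ↔ ∀ m, f.1 m = g.1 m :=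
  ⟨fun h _ => by rw [h], fun h => Subtype.ext (funext h)⟩

/-- Where c ≠ 0, divide. Where c = 0, the derivative of c f = 0 along v reads c ∂_v f + f = 0 and
gives f = 0. This covers the points with p = 0. -/
theorem eq_zero_of_linear_mul {c : PointSpace →L[ℝ] ℝ} {v : PointSpace} (hv : c v = 1)
    {f : smoothFunctions U} (h : linear U c * f = 0) : f = 0 := by
  have h1 := congrArg (pderiv v) h
  rw [Derivation.leibniz, pderiv_linear, hv, map_one, map_zero, smul_eq_mul, smul_eq_mul,
    mul_one] at h1
  refine ext_iff'.2 fun m => ?_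
  have h2 : c m * f.1 m = 0 := ext_iff'.1 h m
  have h3 : c m * (pderiv v f).1 m + f.1 m = 0 := ext_iff'.1 h1 m
  rcases mul_eq_zero.1 h2 with h0 | h0
  · simpa [h0] using h3
  · exact h0

/-- The partial derivatives of smooth functions on `U`. -/
noncomputable def gasCalculus (U : TopologicalSpace.Opens PointSpace) :
    GasCalculus (smoothFunctions U) where
  dt := pderiv (Pi.single 0 1, 0)
  dx i := pderiv (Pi.single i.succ 1, 0)
  du i := pderiv (0, Pi.single (i.castAdd 2) 1)
  dp := pderiv (0, Pi.single 3 1)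
  dq := pderiv (0, Pi.single 4 1)
  u i := linear U (depCoord (i.castAdd 2))
  p := linear U (depCoord 3)
  q := linear U (depCoord 4)
  dx_dt _ _ := pderiv_comm _ _ _
  dx_dx _ _ _ := pderiv_comm _ _ _
  du_dt _ _ := pderiv_comm _ _ _
  du_dx _ _ _ := pderiv_comm _ _ _
  dp_dt _ := pderiv_comm _ _ _
  dp_dx _ _ := pderiv_comm _ _ _
  dp_du _ _ := pderiv_comm _ _ _
  dq_dt _ := pderiv_comm _ _ _
  dq_dx _ _ := pderiv_comm _ _ _
  dq_dp _ := pderiv_comm _ _ _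
  dt_u j := by simp [pderiv_linear, depCoord]
  dx_u i j := by simp [pderiv_linear, depCoord]
  du_u i j := by
    rw [pderiv_linear]
    fin_cases i <;> fin_cases j <;> simp [depCoord]
  dp_u j := by
    rw [pderiv_linear]
    fin_cases j <;> simp [depCoord]
  dq_u j := by
    rw [pderiv_linear]
    fin_cases j <;> simp [depCoord]
  dp_p := by simp [pderiv_linear, depCoord]
  dx_q i := by simp [pderiv_linear, depCoord]
  dt_q := by simp [pderiv_linear, depCoord]
  dq_q := by simp [pderiv_linear, depCoord]
  eq_zero_of_p_mul := eq_zero_of_linear_mul (v := (0, Pi.single 3 1)) (by simp [depCoord])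
  eq_zero_of_q_mul := eq_zero_of_linear_mul (v := (0, Pi.single 4 1)) (by simp [depCoord])

/-- A smooth function of the independent variables on a connected open set with vanishing second
derivatives is affine. -/
theorem exists_affine (hU : IsConnected (U : Set PointSpace)) {f : smoothFunctions U}
    (h1 : ∀ α, pderiv (0, Pi.single α 1) f = 0)
    (h2 : ∀ k l, pderiv (Pi.single k 1, 0) (pderiv (Pi.single l 1, 0) f) = 0) :
    ∃ (c : ℝ) (b : Fin 4 → ℝ), (∀ m : U, f.1 m = c + ∑ k, b k * (m : PointSpace).1 k) ∧
      ∀ k m, (pderiv (Pi.single k 1, 0) f).1 m = b k := by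
  have h3 : ∀ k, ∃ c : ℝ, ∀ m, (pderiv (Pi.single k 1, 0) f).1 m = c := fun k =>
    exists_const hU (h2 · k) fun α => by rw [pderiv_comm, h1, map_zero]
  choose b hb using h3
  obtain ⟨c, hc⟩ := exists_const hU (f := f - linear U (∑ k, b k • indepCoord k)) (fun l => by
      rw [map_sub, pderiv_linear, sub_eq_zero, ext_iff']
      intro m
      rw [hb]
      change b l = (∑ k, b k • indepCoord k) (Pi.single l 1, 0)
      simp [indepCoord, Pi.single_apply]) (fun α => by
      rw [map_sub, h1, pderiv_linear]
      simp [indepCoord])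
  refine ⟨c, b, fun m => ?_, hb⟩
  have : f.1 m - (∑ k, b k • indepCoord k) (m : PointSpace) = c := hc m
  rw [sum_apply] at this
  exact sub_eq_iff_eq_add.1 this

end smoothFunctions

/-! ### From a symmetry to a combination of the generators. -/

open smoothFunctions

theorem IsInfinitesimalSymmetry.determiningEquations {γ : ℝ} (hγ : γ ≠ 0)
    (hq : ∀ m ∈ U, m.2 4 ≠ 0) {X : SmoothVectorField U} (hX : IsInfinitesimalSymmetry γ X) :
    (gasCalculus U).DeterminingEquations γ (component (indepCoord 0) X)
      (fun k => component (indepCoord k.succ) X) (fun k => component (depCoord (k.castAdd 2)) X)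
      (component (depCoord 3) X) (component (depCoord 4) X) := by
  have hinv := fun m : U => hX.invarianceCondition m.2 (hq m m.2)
  have hfib : ∀ k α, pderiv (0, Pi.single α 1) (component (indepCoord k) X) = 0 := by
    intro k α
    -- The pointwise argument needs p ≠ 0. After multiplication by p the claim is trivial at the
    -- other points, and p is cancelled in the algebra.
    refine (gasCalculus U).eq_zero_of_p_mul (ext_iff'.2 fun m => ?_)
    change (m : PointSpace).2 3 * (pderiv _ (component (indepCoord k) X)).1 m = 0
    rw [pderiv_component]
    by_cases hp : (m : PointSpace).2 3 = 0
    · rw [hp, zero_mul]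
    obtain ⟨⟨hτu, hτp, hτd⟩, hζ⟩ := (hinv m).fiber_eq_zero hγ hp (hq m m.2)
    have hτ : ∀ α, indepCoord 0 (fderiv ℝ X m (0, Pi.single α 1)) = 0 := fun α => by
      fin_cases α
      exacts [hτu 0, hτu 1, hτu 2, hτp, hτd]
    have hξ : ∀ k : Fin 3, indepCoord k.succ (fderiv ℝ X m (0, Pi.single α 1)) -
        (m : PointSpace).2 (k.castAdd 2) *
          indepCoord 0 (fderiv ℝ X m (0, Pi.single α 1)) = 0 := fun k => by
      obtain ⟨h1, h2, h3⟩ := hζ k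
      fin_cases α
      exacts [h1 0, h1 1, h1 2, h2, h3]
    refine mul_eq_zero_of_right _ ?_
    refine Fin.cases (hτ α) (fun k => ?_) k
    simpa [hτ α] using hξ k
  have hfib' : ∀ k α (m : U), indepCoord k (fderiv ℝ X m (0, Pi.single α 1)) = 0 :=
    fun k α m => (pderiv_component _ X _ m).symm.trans (ext_iff'.1 (hfib k α) m)
  have hsub : ∀ {x y : ℝ} (c : ℝ), x = 0 → y = 0 → x - c * y = 0 := fun c hx hy => by
    rw [hx, hy, mul_zero, sub_zero]
  have hdet := fun m : U => (hinv m).determining_equations hγ (hq m m.2)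
    ⟨fun j => hfib' 0 _ m, hfib' 0 _ m, hfib' 0 _ m⟩ fun k =>
      ⟨fun j => hsub _ (hfib' k.succ _ m) (hfib' 0 _ m), hsub _ (hfib' k.succ _ m) (hfib' 0 _ m),
        hsub _ (hfib' k.succ _ m) (hfib' 0 _ m)⟩
  have hx : ∀ c i (m : U), ((gasCalculus U).dx i (component c X)).1 m =
    (componentGradient m (fderiv ℝ X m) c).spc i := fun c i m => pderiv_component c X _ m
  have hu : ∀ c i (m : U), ((gasCalculus U).du i (component c X)).1 m =
    (componentGradient m (fderiv ℝ X m) c).vel i := fun c i m => pderiv_component c X _ m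
  have hp : ∀ c (m : U), ((gasCalculus U).dp (component c X)).1 m =
    (componentGradient m (fderiv ℝ X m) c).prs := fun c m => pderiv_component c X _ m
  have hd : ∀ c (m : U), ((gasCalculus U).dq (component c X)).1 m =
    (componentGradient m (fderiv ℝ X m) c).den := fun c m => pderiv_component c X _ m
  have hm : ∀ c (m : U), ((gasCalculus U).mat (component c X)).1 m =
      (componentGradient m (fderiv ℝ X m) c).mat := fun c m => by
    change (pderiv _ (component c X)).1 m + (_ * (pderiv _ (component c X)).1 m +
      _ * (pderiv _ (component c X)).1 m + _ * (pderiv _ (component c X)).1 m) = _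
    rw [pderiv_component, pderiv_component, pderiv_component, pderiv_component]
    rfl
  have hsum : ∀ m : U, ((gasCalculus U).dx 0 (component (depCoord (Fin.castAdd 2 0)) X) +
      (gasCalculus U).dx 1 (component (depCoord (Fin.castAdd 2 1)) X) +
      (gasCalculus U).dx 2 (component (depCoord (Fin.castAdd 2 2)) X)).1 m =
      (componentGradient m (fderiv ℝ X m) (depCoord (Fin.castAdd 2 0))).spc 0 +
      (componentGradient m (fderiv ℝ X m) (depCoord (Fin.castAdd 2 1))).spc 1 +
      (componentGradient m (fderiv ℝ X m) (depCoord (Fin.castAdd 2 2))).spc 2 := fun m => by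
    rw [← hx, ← hx, ← hx]
    rfl
  refine
    { du_τ := fun j => hfib 0 _
      dp_τ := hfib 0 _
      dq_τ := hfib 0 _
      du_ξ := fun j k => hfib k.succ _
      dp_ξ := fun k => hfib k.succ _
      dq_ξ := fun k => hfib k.succ _
      η_eq := fun k => ext_iff'.2 fun m => ?_
      du_π := fun j => ext_iff'.2 fun m => (hu _ j m).trans ((hdet m).2.1.1 j)
      dq_π := ext_iff'.2 fun m => (hd _ m).trans (hdet m).2.1.2
      du_η := fun i k => ext_iff'.2 fun m => ?_
      dp_η := fun h i => ext_iff'.2 fun m => ?_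
      π_eq := ext_iff'.2 fun m => ?_
      mat_η := fun i => ext_iff'.2 fun m => ?_
      mat_ρ := ext_iff'.2 fun m => ?_
      mat_π := ext_iff'.2 fun m => ?_ }
  · have := (hdet m).1 k
    change (X m).2 _ = ((gasCalculus U).mat (component _ X)).1 m -
      (m : PointSpace).2 _ * ((gasCalculus U).mat (component _ X)).1 m
    rw [hm, hm]
    exact this
  · have := (hdet m).2.2.1 i k
    have h1 : ∀ f g : smoothFunctions U, (if i = k then f else g).1 m =
      if i = k then f.1 m else g.1 m := fun f g => by split_ifs <;> rfl
    rw [h1]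
    change (m : PointSpace).2 4 * (((gasCalculus U).du k (component _ X)).1 m +
      (((gasCalculus U).dx i (component _ X)).1 m -
        (m : PointSpace).2 _ * ((gasCalculus U).dx i (component _ X)).1 m)) =
      if i = k then (m : PointSpace).2 4 * (((gasCalculus U).mat (component _ X)).1 m +
        ((gasCalculus U).dp (component _ X)).1 m) - (X m).2 4 else 0
    rw [hm, hu, hx, hx, hp]
    exact this
  · have := (hdet m).2.2.2.1 i ((hd _ m).symm.trans (ext_iff'.1 (h i) m))
    change (m : PointSpace).2 3 * ((m : PointSpace).2 4 *
      ((gasCalculus U).dp (component _ X)).1 m - ((gasCalculus U).dx i (component _ X)).1 m) = 0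
    rw [hp, hx]
    exact this
  · have := (hdet m).2.2.2.2.1
    change (X m).2 3 - (m : PointSpace).2 3 * ((gasCalculus U).dp (component _ X)).1 m +
      (m : PointSpace).2 3 * (((gasCalculus U).mat (component _ X)).1 m +
        ((gasCalculus U).du 0 (component _ X)).1 m - (((gasCalculus U).dx 0 (component _ X)).1 m -
          (m : PointSpace).2 _ * ((gasCalculus U).dx 0 (component _ X)).1 m)) = 0
    rw [hp, hm, hu, hx, hx]
    exact this
  · have := (hdet m).2.2.2.2.2.1 i
    change (m : PointSpace).2 4 * ((gasCalculus U).mat (component _ X)).1 m +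
      ((gasCalculus U).dx i (component _ X)).1 m = 0
    rw [hm, hx]
    exact this
  · have := (hdet m).2.2.2.2.2.2.1
    change ((gasCalculus U).mat (component _ X)).1 m + (m : PointSpace).2 4 * (_ + _ + _ :
      smoothFunctions U).1 m = 0
    rw [hm, hsum]
    exact this
  · have := (hdet m).2.2.2.2.2.2.2
    change ((gasCalculus U).mat (component _ X)).1 m + γ * (m : PointSpace).2 3 * (_ + _ + _ :
      smoothFunctions U).1 m = 0
    rw [hm, hsum]
    exact this

theorem IsInfinitesimalSymmetry.mem_span {γ : ℝ} (hγ : γ ≠ 0) (hγ' : γ ≠ 5 / 3)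
    (hU : IsConnected (U : Set PointSpace)) (hq : ∀ m ∈ U, m.2 4 ≠ 0) {X : SmoothVectorField U}
    (hX : IsInfinitesimalSymmetry γ X) :
    X ∈ Submodule.span ℝ (Set.range (generator U)) := by
  have h := hX.determiningEquations hγ hq
  obtain ⟨c0, b0, hτ, hb0⟩ := exists_affine hU (f := component (indepCoord 0) X)
    (fun α => by
      fin_cases α
      exacts [h.du_τ 0, h.du_τ 1, h.du_τ 2, h.dp_τ, h.dq_τ])
    (fun k l => by
      refine Fin.cases ?_ (fun l => ?_) l
      · refine Fin.cases (h.dt_dt_τ hγ') (fun k => ?_) k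
        exact (pderiv_comm _ _ _).trans ((congrArg _ (h.dx_τ k)).trans (map_zero _))
      · exact (congrArg _ (h.dx_τ l)).trans (map_zero _))
  have hξ := fun i : Fin 3 => exists_affine hU (f := component (indepCoord i.succ) X)
    (fun α => by
      fin_cases α
      exacts [h.du_ξ 0 i, h.du_ξ 1 i, h.du_ξ 2 i, h.dp_ξ i, h.dq_ξ i])
    (fun k l => by
      refine Fin.cases ?_ (fun l => ?_) l
      · refine Fin.cases (h.dt_dt_ξ hγ' i) (fun k => ?_) k
        exact (pderiv_comm _ _ _).trans (h.dt_dx_ξ hγ' i k)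
      · refine Fin.cases (h.dt_dx_ξ hγ' i l) (fun k => ?_) k
        exact h.dx_dx_ξ i l k)
  choose c b hξ hb using hξ
  obtain ⟨a, ha⟩ := exists_const hU (f := (gasCalculus U).dp (component (depCoord 3) X))
    (fun k => Fin.cases (h.dt_dp_π_eq_zero hγ') h.dx_dp_π k)
    (fun α => by
      fin_cases α
      exacts [h.du_dp_π 0, h.du_dp_π 1, h.du_dp_π 2, h.dp_dp_π, h.dq_dp_π])
  obtain ⟨m0, hm0⟩ := hU.nonempty
  have hdxτ : ∀ i : Fin 3, b0 i.succ = 0 := fun i =>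
    (hb0 i.succ ⟨m0, hm0⟩).symm.trans (ext_iff'.1 (h.dx_τ i) _)
  have hadd : ∀ i k : Fin 3, i ≠ k → b i k.succ + b k i.succ = 0 := fun i k hik => by
    rw [← hb i k.succ ⟨m0, hm0⟩, ← hb k i.succ ⟨m0, hm0⟩]
    exact ext_iff'.1 (h.dx_ξ_add hik) _
  have hself : ∀ i k : Fin 3, b i i.succ = b k k.succ := fun i k => by
    rw [← hb i i.succ ⟨m0, hm0⟩, ← hb k k.succ ⟨m0, hm0⟩]
    exact ext_iff'.1 (h.dx_ξ_self i k) _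
  have hη : ∀ (i : Fin 3) (m : U), (X m).2 (i.castAdd 2) = b i 0 + ((m : PointSpace).2 0 * b i 1 +
      (m : PointSpace).2 1 * b i 2 + (m : PointSpace).2 2 * b i 3) -
      (m : PointSpace).2 (i.castAdd 2) * b0 0 := fun i m => by
    have h1 := h.η_eq i
    rw [h.mat_τ] at h1
    have h2 := ext_iff'.1 h1 m
    rw [← hb0 0 m, ← hb i 0 m, ← hb i 1 m, ← hb i 2 m, ← hb i 3 m]
    exact h2
  have hπ : ∀ m : U, (X m).2 3 = (m : PointSpace).2 3 * a := fun m => by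
    rw [← ha m]
    exact ext_iff'.1 h.π_eq_mul m
  have hρ : ∀ m : U, (X m).2 4 = (m : PointSpace).2 4 * (2 * b0 0 + a - 2 * b 0 1) := fun m => by
    rw [← ha m, ← hb0 0 m, ← hb 0 1 m]
    exact ext_iff'.1 (h.ρ_eq 0) m
  -- The coefficients are read off from τ = c0 + b0 0 · t and ξ_i = c i + ∑ b i k x_k, with x_0 = t:
  -- translations, boosts `b i 0`, time scaling, space scaling `b 0 1`, rotations, and a = π_p. The
  -- signs of the last two rotations come from the terms -z∂_y and -z∂_x in them.
  have key : X = ∑ i, ![c 0, c 1, c 2, c0, b 0 0, b 1 0, b 2 0, b0 0, b 0 1, b 0 2, -b 1 3,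
      -b 0 3, a] i • generator U i := SmoothVectorField.ext fun m hm => by
    rw [sum_smul_generator_apply]
    simp only [generator_apply _ hm]
    have h1 : (X m).1 0 = _ := hτ ⟨m, hm⟩
    have h2 : ∀ i : Fin 3, (X m).1 i.succ = _ := fun i => hξ i ⟨m, hm⟩
    have h3 := fun i => hη i ⟨m, hm⟩
    have h4 := hπ ⟨m, hm⟩
    have h5 := hρ ⟨m, hm⟩
    have s1 := hself 1 0
    have s2 := hself 2 0
    have a1 := hadd 0 1 (by decide)
    have a2 := hadd 0 2 (by decide)
    have a3 := hadd 1 2 (by decide)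
    have d0 := hdxτ 0
    have d1 := hdxτ 1
    have d2 := hdxτ 2
    have h20 := h2 0
    have h21 := h2 1
    have h22 := h2 2
    have h30 := h3 0
    have h31 := h3 1
    have h32 := h3 2
    simp [Fin.sum_univ_succ, Fin.succ, Fin.castAdd, Fin.castLE]
      at h1 h20 h21 h22 h30 h31 h32 s1 s2 a1 a2 a3 d0 d1 d2
    refine Prod.ext (funext fun k => ?_) (funext fun k => ?_)
    · fin_cases k <;> simp [Fin.sum_univ_succ, generatorFun, h1, h20, h21, h22] <;> grind
    · fin_cases k <;> simp [Fin.sum_univ_succ, generatorFun, h30, h31, h32, h4, h5] <;> grind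
  rw [key]
  exact Submodule.sum_mem _ fun i _ => Submodule.smul_mem _ _ (Submodule.subset_span ⟨i, rfl⟩)

/-! ### The Lie algebra of symmetries. -/

/-- The space of infinitesimal symmetries of the Euler equations on `U`. -/
noncomputable def symmetrySubmodule (γ : ℝ) (U : TopologicalSpace.Opens PointSpace) :
    Submodule ℝ (SmoothVectorField U) where
  carrier := {X | IsInfinitesimalSymmetry γ X}
  zero_mem' := fun j hj h => by
    have : fderiv ℝ (0 : SmoothVectorField U).1 j.1 = 0 := by
      exact (hasFDerivAt_const (0 : PointSpace) j.1).fderiv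
    rw [prolongation_eq ((0 : SmoothVectorField U).differentiableAt hj), this]
    refine (congrArg _ ?_).trans (map_zero _)
    simp [SmoothVectorField.coe_zero]
    rfl
  add_mem' := fun {X Y} hX hY j hj h => by
    have h1 := hX j hj h
    have h2 := hY j hj h
    rw [prolongation_eq (X.differentiableAt hj)] at h1
    rw [prolongation_eq (Y.differentiableAt hj)] at h2
    rw [prolongation_eq ((X + Y).differentiableAt hj), SmoothVectorField.coe_add,
      fderiv_add (X.differentiableAt hj) (Y.differentiableAt hj)]
    refine (congrArg _ ?_).trans
      (((map_add _ _ _).trans (congrArg₂ (· + ·) h1 h2)).trans (add_zero 0))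
    refine Prod.ext rfl (funext fun α => funext fun i => ?_)
    simp [mul_add, Finset.sum_add_distrib]
    ring
  smul_mem' := fun c X hX j hj h => by
    have h1 := hX j hj h
    rw [prolongation_eq (X.differentiableAt hj)] at h1
    rw [prolongation_eq ((c • X).differentiableAt hj), SmoothVectorField.coe_smul,
      fderiv_const_smul (X.differentiableAt hj)]
    refine (congrArg _ ?_).trans ((map_smul _ c _).trans (by rw [h1, smul_zero]))
    refine Prod.ext rfl (funext fun α => funext fun i => ?_)
    simp [mul_sub, Finset.mul_sum, mul_left_comm]

theorem symmetrySubmodule_eq_span {γ : ℝ} (hγ : γ ≠ 0) (hγ' : γ ≠ 5 / 3)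
    (hU : IsConnected (U : Set PointSpace)) (hq : ∀ m ∈ U, m.2 4 ≠ 0) :
    symmetrySubmodule γ U = Submodule.span ℝ (Set.range (generator U)) :=
  le_antisymm (fun _ hX => IsInfinitesimalSymmetry.mem_span hγ hγ' hU hq hX) <|
    Submodule.span_le.2 <| Set.range_subset_iff.2 fun i =>
      isInfinitesimalSymmetry_generator γ hq i

theorem commutatorTable_mem_span (i j : Fin 13) :
    commutatorTable (generator U) i j ∈ Submodule.span ℝ (Set.range (generator U)) := by
  have hX : ∀ i, generator U i ∈ Submodule.span ℝ (Set.range (generator U)) := fun i =>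
    Submodule.subset_span ⟨i, rfl⟩
  obtain ⟨k0, k1, k2, k3, k4, k5, k6, k7, k8, k9, k10, k11, k12⟩ :=
    commutatorTable_rows (generator U)
  fin_cases i <;>
    simp only [k0, k1, k2, k3, k4, k5, k6, k7, k8, k9, k10, k11, k12, Fin.zero_eta, Fin.mk_one,
      Fin.reduceFinMk] <;>
    fin_cases j <;> simp [hX]

/-- By bilinearity it is enough to bracket two generators, and the table lists those brackets. -/
theorem lie_mem_span_generator {X Y : SmoothVectorField U}
    (hX : X ∈ Submodule.span ℝ (Set.range (generator U)))
    (hY : Y ∈ Submodule.span ℝ (Set.range (generator U))) :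
    ⁅X, Y⁆ ∈ Submodule.span ℝ (Set.range (generator U)) := by
  induction hX, hY using Submodule.span_induction₂ with
  | mem_mem x y hx hy =>
    obtain ⟨i, rfl⟩ := hx
    obtain ⟨j, rfl⟩ := hy
    rw [generator_lie_generator]
    exact commutatorTable_mem_span i j
  | zero_left y hy => rw [zero_lie]; exact Submodule.zero_mem _
  | zero_right x hx => rw [lie_zero]; exact Submodule.zero_mem _
  | add_left x y z hx hy hz h1 h2 => rw [add_lie]; exact Submodule.add_mem _ h1 h2
  | add_right x y z hx hy hz h1 h2 => rw [lie_add]; exact Submodule.add_mem _ h1 h2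
  | smul_left r x y hx hy h => rw [smul_lie]; exact Submodule.smul_mem _ _ h
  | smul_right r x y hx hy h => rw [lie_smul]; exact Submodule.smul_mem _ _ h

end PolytropicGas

theorem theorem1 (γ : ℝ) (U : TopologicalSpace.Opens PolytropicGas.PointSpace)
    (hU : IsConnected (U : Set PolytropicGas.PointSpace)) (hq : ∀ m ∈ U, m.2 4 ≠ 0) :
    (∀ i, PolytropicGas.IsInfinitesimalSymmetry γ (PolytropicGas.generator U i)) ∧
    LinearIndependent ℝ (PolytropicGas.generator U) ∧
    (∀ i j, ⁅PolytropicGas.generator U i, PolytropicGas.generator U j⁆ =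
      PolytropicGas.commutatorTable (PolytropicGas.generator U) i j) ∧
    (γ ≠ 0 → γ ≠ 5 / 3 →
      ∃ 𝔤 : LieSubalgebra ℝ (PolytropicGas.SmoothVectorField U),
        (∀ X, X ∈ 𝔤 ↔ PolytropicGas.IsInfinitesimalSymmetry γ X) ∧
        𝔤.toSubmodule = Submodule.span ℝ (Set.range (PolytropicGas.generator U))) := by
  refine ⟨PolytropicGas.isInfinitesimalSymmetry_generator γ hq,
    PolytropicGas.linearIndependent_generator hU.nonempty, PolytropicGas.generator_lie_generator,
    fun hγ hγ' => ?_⟩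
  have h := PolytropicGas.symmetrySubmodule_eq_span hγ hγ' hU hq
  refine ⟨{ PolytropicGas.symmetrySubmodule γ U with
    lie_mem' := fun {X Y} hX hY => ?_ }, fun X => Iff.rfl, h⟩
  change ⁅X, Y⁆ ∈ PolytropicGas.symmetrySubmodule γ U
  -- Closure is checked on the span, so no identity for the prolongation of a commutator is needed.
  rw [h]
  exact PolytropicGas.lie_mem_span_generator (h ▸ hX) (h ▸ hY)
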